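/- Let $-\infty<a<b<\infty$ and $\beta\ge 0$. For $k\in\{\mathrm I,\mathrm{II},\mathrm{III}\}$ let $T_k,\rho_k\in L_\infty(a,b)$ be real-valued, and assume that there is $\varepsilon_0>0$ such that $T_k(\zeta)\ge\varepsilon_0$ and $\rho_k(\zeta)\ge\varepsilon_0$ for almost every $\zeta\in(a,b)$ and all $k$. Let $$P_1=\operatorname{diag}\left(\begin{bmatrix}0&1\\1&0\end{bmatrix},\begin{bmatrix}0&1\\1&0\end{bmatrix},\begin{bmatrix}0&1\\1&0\end{bmatrix}\right)\in\mathbb C^{6\times 6},\qquad \mathcal H(\zeta)=\operatorname{diag}\left(\tfrac1{\rho_{\mathrm I}(\zeta)},T_{\mathrm I}(\zeta),\tfrac1{\rho_{\mathrm{II}}(\zeta)},T_{\mathrm{II}}(\zeta),\tfrac1{\rho_{\mathrm{III}}(\zeta)},T_{\mathrm{III}}(\zeta)\right),$$ and let $X=L_{2,\mathcal H}((a,b);\mathbb C^6)$ be the space $L_2((a,b);\mathbb C^6)$ with the inner product $$\langle f,g\rangle_{\mathcal H}=\frac12\int_a^b g(\zeta)^*\mathcal H(\zeta)f(\zeta)\,d\zeta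 .$$ Let $$W_B=\left(\begin{array}{cccccc|cccccc} 1&0&-1&0&0&0&0&0&0&0&0&0\\ 1&0&0&0&-1&0&0&0&0&0&0&0\\ \beta&1&0&1&0&1&0&0&0&0&0&0\\ 0&0&0&0&0&0&1&0&0&0&0&0\\ 0&0&0&0&0&0&0&0&0&1&0&0\\ 0&0&0&0&0&0&0&0&0&0&0&1 \end{array}\right).$$ Then the operator $A x=P_1\frac{d}{d\zeta}(\mathcal H x)$ in $X$ with domain $$\operatorname{dom}(A)=\left\{x\in X \;\middle|\; \mathcal Hx\in H^1((a,b);\mathbb C^6),\ W_B\begin{pmatrix}(\mathcal Hx)(b)\\(\mathcal Hx)(a)\end{pmatrix}=0\right\}$$ is the infinitesimal generator of a contraction semigroup on $X$, that is, of a strongly continuous semigroup $(S(t))_{t\ge0}$ of bounded linear operators on $X$ with $\|S(t)\|\le1$ for all $t\ge 0$. -/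

import Mathlib

open MeasureTheory Set Filter Topology
open scoped NNReal ENNReal ContDiff Matrix ComplexOrder

namespace PortHamiltonian

/-! ### Contraction semigroups and their generators -/

section Semigroup

variable {X : Type*} [NormedAddCommGroup X] [NormedSpace ℂ X]

/-- A strongly continuous semigroup of contractions `(T t)` for `t ≥ 0`. -/
structure IsContractionSemigroup (T : ℝ≥0 → X →L[ℂ] X) : Prop where
  map_zero : T 0 = ContinuousLinearMap.id ℂ X
  map_add : ∀ s t, T (s + t) = (T s).comp (T t)
  strongly_continuous : ∀ x, Tendsto (fun t => T t x) (𝓝[>] 0) (𝓝 x)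
  contraction : ∀ t, ‖T t‖ ≤ 1

/-- `A`, with its domain, is the infinitesimal generator of `T`: a vector `x` lies in `dom A`
and `A x = y` if and only if `(T t x - x) / t` tends to `y` as `t` decreases to `0`. -/
def IsGenerator (A : X →ₗ.[ℂ] X) (T : ℝ≥0 → X →L[ℂ] X) : Prop :=
  ∀ x y : X, (x, y) ∈ A.graph ↔
    Tendsto (fun t : ℝ≥0 => (((t : ℝ) : ℂ)⁻¹) • (T t x - x)) (𝓝[>] 0) (𝓝 y)

/-- `A` is the generator of a contraction semigroup. -/
def GeneratesContractionSemigroup (A : X →ₗ.[ℂ] X) : Prop :=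
  ∃ T : ℝ≥0 → X →L[ℂ] X, IsContractionSemigroup T ∧ IsGenerator A T

end Semigroup

/-! ### The Sobolev space `H¹(a,b)` -/

section Sobolev

variable {E : Type*} [NormedAddCommGroup E] [NormedSpace ℝ E]

/-- Lebesgue measure on the open interval `(a,b)`. -/
noncomputable abbrev intervalMeasure (a b : ℝ) : Measure ℝ := volume.restrict (Ioo a b)

/-- `g` is a weak derivative of `u` on `(a,b)`. -/
def IsWeakDeriv (a b : ℝ) (u g : ℝ → E) : Prop :=
  ∀ φ : ℝ → ℝ, ContDiff ℝ ∞ φ → HasCompactSupport φ → tsupport φ ⊆ Ioo a b →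
    ∫ ζ in Ioo a b, deriv φ ζ • u ζ = -∫ ζ in Ioo a b, φ ζ • g ζ

/-- `u ∈ H¹((a,b); E)`. -/
def MemH1 (a b : ℝ) (u : ℝ → E) : Prop :=
  MemLp u 2 (intervalMeasure a b) ∧
    ∃ g : ℝ → E, MemLp g 2 (intervalMeasure a b) ∧ IsWeakDeriv a b u g

theorem integrable_smul_test {a b : ℝ} {u : ℝ → E} (hu : MemLp u 2 (intervalMeasure a b))
    {φ : ℝ → ℝ} (hφ : Continuous φ) (hc : HasCompactSupport φ) :
    Integrable (fun ζ => φ ζ • u ζ) (intervalMeasure a b) := by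
  have h1 : Integrable u (intervalMeasure a b) := hu.integrable (by norm_num)
  obtain ⟨C, hC⟩ := hc.exists_bound_of_continuous hφ
  exact h1.bdd_smul C hφ.aestronglyMeasurable (ae_of_all _ hC)

theorem IsWeakDeriv.add {a b : ℝ} {u g u' g' : ℝ → E}
    (hu : MemLp u 2 (intervalMeasure a b)) (hg : MemLp g 2 (intervalMeasure a b))
    (hu' : MemLp u' 2 (intervalMeasure a b)) (hg' : MemLp g' 2 (intervalMeasure a b))
    (h : IsWeakDeriv a b u g) (h' : IsWeakDeriv a b u' g') :
    IsWeakDeriv a b (fun ζ => u ζ + u' ζ) (fun ζ => g ζ + g' ζ) := by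
  intro φ h1 h2 h3
  have hd : Continuous (deriv φ) := h1.continuous_deriv (by simp)
  have hdc : HasCompactSupport (deriv φ) := h2.deriv
  simp only [smul_add]
  rw [integral_add (integrable_smul_test hu hd hdc) (integrable_smul_test hu' hd hdc),
    integral_add (integrable_smul_test hg h1.continuous h2)
      (integrable_smul_test hg' h1.continuous h2), h φ h1 h2 h3, h' φ h1 h2 h3]
  abel

theorem IsWeakDeriv.const_smul [NormedSpace ℂ E] {a b : ℝ} {u g : ℝ → E} (c : ℂ)
    (h : IsWeakDeriv a b u g) :
    IsWeakDeriv a b (fun ζ => c • u ζ) (fun ζ => c • g ζ) := by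
  intro φ h1 h2 h3
  simp only [smul_comm _ c]
  rw [integral_smul, integral_smul, h φ h1 h2 h3, smul_neg]

theorem IsWeakDeriv.congr {a b : ℝ} {u g u' : ℝ → E}
    (h : IsWeakDeriv a b u g) (hu : u =ᵐ[intervalMeasure a b] u') :
    IsWeakDeriv a b u' g := by
  intro φ h1 h2 h3
  rw [← h φ h1 h2 h3]
  refine integral_congr_ae ?_
  filter_upwards [hu] with ζ hζ
  rw [hζ]

/-- Weak derivatives are unique up to null sets. -/
theorem IsWeakDeriv.unique [CompleteSpace E] {a b : ℝ} {u g g' : ℝ → E}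
    (hg : MemLp g 2 (intervalMeasure a b)) (hg' : MemLp g' 2 (intervalMeasure a b))
    (h : IsWeakDeriv a b u g) (h' : IsWeakDeriv a b u g') :
    g =ᵐ[intervalMeasure a b] g' := by
  have hi : Integrable (fun ζ => g ζ - g' ζ) (intervalMeasure a b) :=
    (hg.sub hg').integrable (by norm_num)
  have key : ∀ᵐ ζ ∂volume, ζ ∈ Ioo a b → g ζ - g' ζ = 0 := by
    refine isOpen_Ioo.ae_eq_zero_of_integral_contDiff_smul_eq_zero
      (IntegrableOn.locallyIntegrableOn hi) ?_
    intro φ h1 h2 h3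
    have e : ∫ ζ, φ ζ • (g ζ - g' ζ) = ∫ ζ in Ioo a b, φ ζ • (g ζ - g' ζ) := by
      symm
      refine setIntegral_eq_integral_of_forall_compl_eq_zero ?_
      intro x hx
      rw [image_eq_zero_of_notMem_tsupport (fun hh => hx (h3 hh)), zero_smul]
    rw [e]
    simp only [smul_sub]
    rw [integral_sub (integrable_smul_test hg h1.continuous h2)
      (integrable_smul_test hg' h1.continuous h2)]
    have := (h φ h1 h2 h3).symm.trans (h' φ h1 h2 h3)
    rw [neg_inj] at this
    rw [this, sub_self]
  have := (ae_restrict_iff' (μ := volume) measurableSet_Ioo).2 key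
  filter_upwards [this] with ζ hζ
  exact sub_eq_zero.1 hζ

/-- The weak derivative of a function in `H¹`, unique up to null sets. -/
noncomputable def weakDeriv {a b : ℝ} {u : ℝ → E} (hu : MemH1 a b u) :
    ℝ → E :=
  hu.2.choose

theorem memLp_weakDeriv {a b : ℝ} {u : ℝ → E} (hu : MemH1 a b u) :
    MemLp (weakDeriv hu) 2 (intervalMeasure a b) :=
  hu.2.choose_spec.1

theorem isWeakDeriv_weakDeriv {a b : ℝ} {u : ℝ → E} (hu : MemH1 a b u) :
    IsWeakDeriv a b u (weakDeriv hu) :=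
  hu.2.choose_spec.2

end Sobolev

/-! ### Hamiltonian densities and the energy space -/

variable {ι κ : Type*} [Fintype ι]

/-- A Hamiltonian density on `(a,b)`: a measurable, uniformly bounded, Hermitian matrix function
with `ℋ(ζ) ≥ m I` for almost all `ζ`, for some `m > 0`. -/
structure HamiltonianDensity (a b : ℝ) (ι : Type*) [Fintype ι] [DecidableEq ι] where
  toFun : ℝ → Matrix ι ι ℂ
  aestronglyMeasurable : ∀ i j,
    AEStronglyMeasurable (fun ζ => toFun ζ i j) (intervalMeasure a b)
  bounded : ∃ M : ℝ, ∀ᵐ ζ ∂(intervalMeasure a b), ∀ i j, ‖toFun ζ i j‖ ≤ M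
  isHermitian : ∀ᵐ ζ ∂(intervalMeasure a b), (toFun ζ).IsHermitian
  coercive : ∃ m : ℝ, 0 < m ∧
    ∀ᵐ ζ ∂(intervalMeasure a b), (toFun ζ - (m : ℂ) • (1 : Matrix ι ι ℂ)).PosSemidef

/-- A matrix acting on `ℂⁿ` with its Euclidean norm. -/
noncomputable def matVec {κ : Type*} (M : Matrix κ ι ℂ) (v : EuclideanSpace ℂ ι) :
    EuclideanSpace ℂ κ :=
  WithLp.toLp 2 (M *ᵥ v.ofLp)

theorem matVec_apply (M : Matrix κ ι ℂ) (v : EuclideanSpace ℂ ι) (i : κ) :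
    matVec M v i = ∑ j, M i j * v j := rfl

theorem matVec_add (M : Matrix κ ι ℂ) (v w : EuclideanSpace ℂ ι) :
    matVec M (v + w) = matVec M v + matVec M w := by
  ext i
  simp [matVec, Matrix.mulVec_add]

theorem matVec_smul (M : Matrix κ ι ℂ) (c : ℂ) (v : EuclideanSpace ℂ ι) :
    matVec M (c • v) = c • matVec M v := by
  ext i
  simp [matVec, Matrix.mulVec_smul]

theorem memLp_matVec {a b : ℝ} {M : ℝ → Matrix ι ι ℂ}
    (hm : ∀ i j, AEStronglyMeasurable (fun ζ => M ζ i j) (intervalMeasure a b))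
    (hb : ∃ C : ℝ, ∀ᵐ ζ ∂(intervalMeasure a b), ∀ i j, ‖M ζ i j‖ ≤ C)
    {u : ℝ → EuclideanSpace ℂ ι} (hu : MemLp u 2 (intervalMeasure a b)) :
    MemLp (fun ζ => matVec (M ζ) (u ζ)) 2 (intervalMeasure a b) := by
  obtain ⟨C, hC⟩ := hb
  have hcoord : ∀ j, MemLp (fun ζ => u ζ j) 2 (intervalMeasure a b) := fun j =>
    (EuclideanSpace.proj (𝕜 := ℂ) j : EuclideanSpace ℂ ι →L[ℂ] ℂ).comp_memLp' hu
  have hcomp : ∀ i, MemLp (fun ζ => matVec (M ζ) (u ζ) i) 2 (intervalMeasure a b) := by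
    intro i
    simp only [matVec_apply]
    refine memLp_finsetSum _ fun j _ => ?_
    refine MemLp.mul (p := ⊤) (q := 2) (hcoord j) ?_
    exact memLp_top_of_bound (hm i j) C (hC.mono fun ζ h => h i j)
  have hpi : MemLp (fun ζ => (WithLp.ofLp (matVec (M ζ) (u ζ)))) 2 (intervalMeasure a b) :=
    memLp_pi_iff.2 hcomp
  exact ((PiLp.continuousLinearEquiv 2 ℂ (fun _ : ι => ℂ)).symm :
    (ι → ℂ) →L[ℂ] EuclideanSpace ℂ ι).comp_memLp' hpi

theorem memLp_const_matVec (P : Matrix ι ι ℂ) {a b : ℝ} {u : ℝ → EuclideanSpace ℂ ι}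
    (hu : MemLp u 2 (intervalMeasure a b)) :
    MemLp (fun ζ => matVec P (u ζ)) 2 (intervalMeasure a b) :=
  memLp_matVec (M := fun _ => P) (fun _ _ => aestronglyMeasurable_const)
    ⟨∑ i, ∑ j, ‖P i j‖, ae_of_all _ fun _ i j =>
      (Finset.single_le_sum (f := fun j => ‖P i j‖) (fun _ _ => norm_nonneg _)
        (Finset.mem_univ j)).trans
      (Finset.single_le_sum (f := fun i => ∑ j, ‖P i j‖)
        (fun _ _ => Finset.sum_nonneg fun _ _ => norm_nonneg _) (Finset.mem_univ i))⟩ hu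

variable [DecidableEq ι]

/-- The energy space of `H`: as a set, `L₂((a,b); ℂⁿ)`; the inner product is weighted by `H`. -/
def EnergySpace {a b : ℝ} (_H : HamiltonianDensity a b ι) : Type _ :=
  Lp (EuclideanSpace ℂ ι) 2 (intervalMeasure a b)

section Energy

variable {a b : ℝ} (H : HamiltonianDensity a b ι)

noncomputable instance : AddCommGroup (EnergySpace H) :=
  inferInstanceAs (AddCommGroup (Lp (EuclideanSpace ℂ ι) 2 (intervalMeasure a b)))

noncomputable instance : Module ℂ (EnergySpace H) :=
  inferInstanceAs (Module ℂ (Lp (EuclideanSpace ℂ ι) 2 (intervalMeasure a b)))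

variable {H}

/-- An element of the energy space, seen as an element of `L₂`. -/
def EnergySpace.toL2 (x : EnergySpace H) : Lp (EuclideanSpace ℂ ι) 2 (intervalMeasure a b) := x

/-- An element of `L₂`, seen as an element of the energy space. -/
def EnergySpace.ofL2 (x : Lp (EuclideanSpace ℂ ι) 2 (intervalMeasure a b)) : EnergySpace H := x

/-- The function `ζ ↦ ℋ(ζ) x(ζ)`. -/
noncomputable def EnergySpace.effort (x : EnergySpace H) : ℝ → EuclideanSpace ℂ ι :=
  fun ζ => matVec (H.toFun ζ) (x.toL2 ζ)

theorem EnergySpace.memLp_effort (x : EnergySpace H) :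
    MemLp x.effort 2 (intervalMeasure a b) :=
  memLp_matVec H.aestronglyMeasurable H.bounded (Lp.memLp x.toL2)

theorem EnergySpace.effort_add (x y : EnergySpace H) :
    (x + y).effort =ᵐ[intervalMeasure a b] fun ζ => x.effort ζ + y.effort ζ := by
  filter_upwards [Lp.coeFn_add x.toL2 y.toL2] with ζ hζ
  change matVec _ ((x.toL2 + y.toL2 : Lp _ _ _) ζ) = _
  rw [hζ, Pi.add_apply, matVec_add]
  rfl

theorem EnergySpace.effort_smul (c : ℂ) (x : EnergySpace H) :
    (c • x).effort =ᵐ[intervalMeasure a b] fun ζ => c • x.effort ζ := by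
  filter_upwards [Lp.coeFn_smul c x.toL2] with ζ hζ
  change matVec _ ((c • x.toL2 : Lp _ _ _) ζ) = _
  rw [hζ, Pi.smul_apply, matVec_smul]
  rfl

/-- The energy inner product `½ ∫ g(ζ)* ℋ(ζ) f(ζ) dζ` over `(a,b)`, in the convention that it is
conjugate linear in the first argument `g`. -/
noncomputable def energyInner (g f : EnergySpace H) : ℂ :=
  (1 / 2 : ℂ) * ∫ ζ in Ioo a b, star (g.toL2 ζ).ofLp ⬝ᵥ (H.toFun ζ *ᵥ (f.toL2 ζ).ofLp)

theorem energyInner_eq (g f : EnergySpace H) :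
    energyInner g f = (1 / 2 : ℂ) * ∫ ζ in Ioo a b, inner ℂ (g.toL2 ζ) (f.effort ζ) := by
  simp only [energyInner, EnergySpace.effort, matVec, EuclideanSpace.inner_eq_star_dotProduct]
  congr 2
  funext ζ
  exact dotProduct_comm _ _

theorem integrable_energy (g f : EnergySpace H) :
    Integrable (fun ζ => inner ℂ (g.toL2 ζ) (f.effort ζ)) (intervalMeasure a b) := by
  have h := L2.integrable_inner (𝕜 := ℂ) g.toL2 (f.memLp_effort.toLp)
  refine h.congr ?_
  filter_upwards [f.memLp_effort.coeFn_toLp] with ζ hζ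
  rw [hζ]

theorem energy_coercive : ∃ m : ℝ, 0 < m ∧ ∀ x : EnergySpace H,
    ∀ᵐ ζ ∂(intervalMeasure a b),
      m * ‖x.toL2 ζ‖ ^ 2 ≤ (inner ℂ (x.toL2 ζ) (x.effort ζ)).re := by
  obtain ⟨m, hm, h⟩ := H.coercive
  refine ⟨m, hm, fun x => ?_⟩
  filter_upwards [h] with ζ hζ
  have h0 := hζ.re_dotProduct_nonneg (x.toL2 ζ).ofLp
  have h1 : inner ℂ (x.toL2 ζ) (x.effort ζ) =
      star (x.toL2 ζ).ofLp ⬝ᵥ (H.toFun ζ *ᵥ (x.toL2 ζ).ofLp) := by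
    simp only [EnergySpace.effort, matVec, EuclideanSpace.inner_eq_star_dotProduct]
    exact dotProduct_comm _ _
  have h2 : star (x.toL2 ζ).ofLp ⬝ᵥ (x.toL2 ζ).ofLp = ((‖x.toL2 ζ‖ ^ 2 : ℝ) : ℂ) := by
    have := inner_self_eq_norm_sq_to_K (𝕜 := ℂ) (x.toL2 ζ)
    rw [EuclideanSpace.inner_eq_star_dotProduct, dotProduct_comm] at this
    rw [this]
    norm_cast
  rw [Matrix.sub_mulVec, Matrix.smul_mulVec, Matrix.one_mulVec, dotProduct_sub,
    dotProduct_smul, h2, ← h1] at h0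
  have h3 : (((m : ℂ) • ((‖x.toL2 ζ‖ ^ 2 : ℝ) : ℂ)).re) = m * ‖x.toL2 ζ‖ ^ 2 := by
    rw [smul_eq_mul, ← Complex.ofReal_mul, Complex.ofReal_re]
  simp only [map_sub, RCLike.re_to_complex, h3] at h0
  linarith

theorem energyInner_self_re (x : EnergySpace H) :
    (energyInner x x).re =
      (1 / 2 : ℝ) * ∫ ζ in Ioo a b, (inner ℂ (x.toL2 ζ) (x.effort ζ)).re := by
  have h := integral_re (𝕜 := ℂ) (integrable_energy x x)
  simp only [RCLike.re_to_complex] at h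
  rw [energyInner_eq, h]
  simp [Complex.mul_re]

variable (H)

/-- The weighted inner product is an inner product. -/
@[reducible] noncomputable def energyCore : InnerProductSpace.Core ℂ (EnergySpace H) where
  inner := energyInner
  conj_inner_symm := by
    intro x y
    simp only [energyInner_eq, map_mul]
    rw [← integral_conj]
    congr 1
    · simp [Complex.conj_ofNat]
    · refine integral_congr_ae ?_
      filter_upwards [H.isHermitian] with ζ hζ
      rw [inner_conj_symm]
      simp only [EnergySpace.effort, matVec, EuclideanSpace.inner_eq_star_dotProduct]
      rw [Matrix.star_mulVec, hζ.eq, dotProduct_comm, ← Matrix.dotProduct_mulVec,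
        dotProduct_comm]
  re_inner_nonneg := by
    intro x
    obtain ⟨m, hm, h⟩ := energy_coercive (H := H)
    change 0 ≤ (energyInner x x).re
    rw [energyInner_self_re]
    refine mul_nonneg (by norm_num) (integral_nonneg_of_ae ?_)
    filter_upwards [h x] with ζ hζ
    exact le_trans (by positivity) hζ
  add_left := by
    intro x y z
    simp only [energyInner_eq]
    rw [← mul_add, ← integral_add (integrable_energy x z) (integrable_energy y z)]
    congr 1
    refine integral_congr_ae ?_
    filter_upwards [Lp.coeFn_add x.toL2 y.toL2] with ζ hζ
    change inner ℂ ((x.toL2 + y.toL2 : Lp _ _ _) ζ) _ = _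
    rw [hζ, Pi.add_apply, inner_add_left]
  smul_left := by
    intro x y c
    simp only [energyInner_eq]
    rw [mul_left_comm]
    congr 1
    rw [← integral_const_mul]
    refine integral_congr_ae ?_
    filter_upwards [Lp.coeFn_smul c x.toL2] with ζ hζ
    change inner ℂ ((c • x.toL2 : Lp _ _ _) ζ) _ = _
    rw [hζ, Pi.smul_apply, inner_smul_left]
  definite := by
    intro x hx
    obtain ⟨m, hm, h⟩ := energy_coercive (H := H)
    have h0 := energyInner_self_re x
    change energyInner x x = 0 at hx
    rw [hx, Complex.zero_re] at h0
    have h1 : ∫ ζ in Ioo a b, (inner ℂ (x.toL2 ζ) (x.effort ζ)).re = 0 := by linarith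
    have hnn : 0 ≤ᵐ[intervalMeasure a b]
        fun ζ => (inner ℂ (x.toL2 ζ) (x.effort ζ)).re := by
      filter_upwards [h x] with ζ hζ
      exact le_trans (by positivity) hζ
    have h2 := (integral_eq_zero_iff_of_nonneg_ae hnn (integrable_energy x x).re).1 h1
    have h3 : x.toL2 = 0 := by
      refine Lp.eq_zero_iff_ae_eq_zero.2 ?_
      filter_upwards [h2, h x] with ζ hz hζ
      rw [hz] at hζ
      simp only [Pi.zero_apply] at hζ ⊢
      have : ‖x.toL2 ζ‖ ^ 2 ≤ 0 := by
        by_contra hcon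
        push Not at hcon
        nlinarith [mul_pos hm hcon]
      have h5 : ‖x.toL2 ζ‖ ^ 2 = 0 := le_antisymm this (by positivity)
      exact norm_eq_zero.1 (pow_eq_zero_iff two_ne_zero |>.1 h5)
    exact h3

noncomputable instance : NormedAddCommGroup (EnergySpace H) :=
  (energyCore H).toNormedAddCommGroup

noncomputable instance : InnerProductSpace ℂ (EnergySpace H) :=
  InnerProductSpace.ofCore (energyCore H).toCore

end Energy

/-! ### The port-Hamiltonian operator of first order -/

section Operator

variable {a b : ℝ}

/-- The domain of `P₁ d/dζ ℋ`: all `x` in the energy space with `ℋx ∈ H¹((a,b); ℂⁿ)` and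
`W ((ℋx)(b), (ℋx)(a)) = 0`, the values at the end points being those of the representative `v` of
`ℋx` that is continuous on `[a,b]`. -/
def InDomain (H : HamiltonianDensity a b ι) (W : Matrix κ (ι ⊕ ι) ℂ) (x : EnergySpace H) : Prop :=
  MemH1 a b x.effort ∧
    ∃ v : ℝ → EuclideanSpace ℂ ι, ContinuousOn v (Icc a b) ∧
      v =ᵐ[intervalMeasure a b] x.effort ∧ W *ᵥ Sum.elim (v b).ofLp (v a).ofLp = 0

/-- The domain, as a subspace of the energy space. -/
noncomputable def domain (H : HamiltonianDensity a b ι) (W : Matrix κ (ι ⊕ ι) ℂ) :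
    Submodule ℂ (EnergySpace H) where
  carrier := {x | InDomain H W x}
  zero_mem' := by
    have h0 : (0 : EnergySpace H).effort =ᵐ[intervalMeasure a b] fun _ => 0 := by
      have := EnergySpace.effort_smul (0 : ℂ) (0 : EnergySpace H)
      simpa using this
    refine ⟨⟨EnergySpace.memLp_effort _, fun _ => 0, MemLp.zero', ?_⟩, fun _ => 0,
      continuousOn_const, h0.symm, ?_⟩
    · refine IsWeakDeriv.congr (u := fun _ => 0) ?_ h0.symm
      intro φ _ _ _
      simp
    · ext i
      simp [Matrix.mulVec, dotProduct]
  add_mem' := by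
    rintro x y ⟨⟨hx, g, hg, hgx⟩, v, hv, hvx, hvW⟩ ⟨⟨hy, g', hg', hgy⟩, w, hw, hwy, hwW⟩
    refine ⟨⟨EnergySpace.memLp_effort _, fun ζ => g ζ + g' ζ, hg.add hg', ?_⟩,
      fun ζ => v ζ + w ζ, hv.add hw, ?_, ?_⟩
    · exact (hgx.add hx hg hy hg' hgy).congr (EnergySpace.effort_add x y).symm
    · filter_upwards [hvx, hwy, EnergySpace.effort_add x y] with ζ h1 h2 h3
      rw [h3, h1, h2]
    · have e : Sum.elim (v b + w b).ofLp (v a + w a).ofLp =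
          Sum.elim (v b).ofLp (v a).ofLp + Sum.elim (w b).ofLp (w a).ofLp := by
        funext i
        cases i <;> simp
      rw [e, Matrix.mulVec_add, hvW, hwW, add_zero]
  smul_mem' := by
    rintro c x ⟨⟨hx, g, hg, hgx⟩, v, hv, hvx, hvW⟩
    refine ⟨⟨EnergySpace.memLp_effort _, fun ζ => c • g ζ, hg.const_smul c, ?_⟩,
      fun ζ => c • v ζ, hv.const_smul c, ?_, ?_⟩
    · exact (hgx.const_smul c).congr (EnergySpace.effort_smul c x).symm
    · filter_upwards [hvx, EnergySpace.effort_smul c x] with ζ h1 h3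
      rw [h3, h1]
    · have e : Sum.elim (c • v b).ofLp (c • v a).ofLp =
          c • Sum.elim (v b).ofLp (v a).ofLp := by
        funext i
        cases i <;> simp
      rw [e, Matrix.mulVec_smul, hvW, smul_zero]

theorem memH1_effort {H : HamiltonianDensity a b ι} {W : Matrix κ (ι ⊕ ι) ℂ}
    (x : domain H W) : MemH1 a b x.1.effort :=
  x.2.1

/-- The operator `A x = P d/dζ (ℋ x)` on the domain given by the boundary matrix `W`. -/
noncomputable def operator (P : Matrix ι ι ℂ) (H : HamiltonianDensity a b ι)
    (W : Matrix κ (ι ⊕ ι) ℂ) : EnergySpace H →ₗ.[ℂ] EnergySpace H where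
  domain := domain H W
  toFun :=
    { toFun := fun x => EnergySpace.ofL2
        ((memLp_const_matVec P (memLp_weakDeriv (memH1_effort x))).toLp)
      map_add' := by
        intro x y
        have hu := ((isWeakDeriv_weakDeriv (memH1_effort x)).add (memH1_effort x).1 (memLp_weakDeriv (memH1_effort x)) (memH1_effort y).1
          (memLp_weakDeriv (memH1_effort y)) (isWeakDeriv_weakDeriv (memH1_effort y))).congr
          (EnergySpace.effort_add x.1 y.1).symm
        have hq := (isWeakDeriv_weakDeriv (memH1_effort (x + y))).unique (memLp_weakDeriv (memH1_effort (x + y)))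
          ((memLp_weakDeriv (memH1_effort x)).add (memLp_weakDeriv (memH1_effort y))) hu
        change MemLp.toLp _ _ = MemLp.toLp _ _ + MemLp.toLp _ _
        refine Eq.trans ?_ (MemLp.toLp_add _ _)
        refine MemLp.toLp_congr _ _ ?_
        filter_upwards [hq] with ζ hζ
        rw [hζ, Pi.add_apply, matVec_add]
        rfl
      map_smul' := by
        intro c x
        have hu := ((isWeakDeriv_weakDeriv (memH1_effort x)).const_smul c).congr
          (EnergySpace.effort_smul c x.1).symm
        have hq := (isWeakDeriv_weakDeriv (memH1_effort (c • x))).unique (memLp_weakDeriv (memH1_effort (c • x)))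
          ((memLp_weakDeriv (memH1_effort x)).const_smul c) hu
        change MemLp.toLp _ _ = c • MemLp.toLp _ _
        refine Eq.trans ?_ (MemLp.toLp_const_smul c _)
        refine MemLp.toLp_congr _ _ ?_
        filter_upwards [hq] with ζ hζ
        rw [hζ, Pi.smul_apply, matVec_smul]
        rfl }

end Operator

/-! ### The network of three strings -/

section Network

/-- The matrix `P₁`: three diagonal blocks, one for each string. -/
def stringP : Matrix (Fin 6) (Fin 6) ℂ :=
  !![0, 1, 0, 0, 0, 0;
     1, 0, 0, 0, 0, 0;
     0, 0, 0, 1, 0, 0;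
     0, 0, 1, 0, 0, 0;
     0, 0, 0, 0, 0, 1;
     0, 0, 0, 0, 1, 0]

/-- The matrix `W_B`: the left block acts on `(ℋx)(b)`, the right block on `(ℋx)(a)`. -/
def stringW (β : ℝ) : Matrix (Fin 6) (Fin 6 ⊕ Fin 6) ℂ :=
  Matrix.fromCols
    !![1, 0, -1, 0, 0, 0;
       1, 0, 0, 0, -1, 0;
       (β : ℂ), 1, 0, 1, 0, 1;
       0, 0, 0, 0, 0, 0;
       0, 0, 0, 0, 0, 0;
       0, 0, 0, 0, 0, 0]
    !![0, 0, 0, 0, 0, 0;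
       0, 0, 0, 0, 0, 0;
       0, 0, 0, 0, 0, 0;
       1, 0, 0, 0, 0, 0;
       0, 0, 0, 1, 0, 0;
       0, 0, 0, 0, 0, 1]

/-- The diagonal `(1/ρ_I, T_I, 1/ρ_II, T_II, 1/ρ_III, T_III)` of the Hamiltonian density. -/
noncomputable def stringDiag (T ρ : Fin 3 → ℝ → ℝ) (ζ : ℝ) : Fin 6 → ℝ :=
  ![(ρ 0 ζ)⁻¹, T 0 ζ, (ρ 1 ζ)⁻¹, T 1 ζ, (ρ 2 ζ)⁻¹, T 2 ζ]

variable {a b : ℝ}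

theorem ae_le_of_memLp_top {f : ℝ → ℝ} (hf : MemLp f ⊤ (intervalMeasure a b)) :
    ∃ C : ℝ, 0 < C ∧ ∀ᵐ ζ ∂(intervalMeasure a b), |f ζ| ≤ C := by
  refine ⟨(eLpNorm f ⊤ (intervalMeasure a b)).toReal + 1, by positivity, ?_⟩
  filter_upwards [ae_le_eLpNormEssSup (f := f) (μ := intervalMeasure a b)] with ζ hζ
  rw [← eLpNorm_exponent_top] at hζ
  have := ENNReal.toReal_mono hf.2.ne hζ
  simp only [toReal_enorm, Real.norm_eq_abs] at this
  linarith

/-- The Hamiltonian density of the network of three strings with coefficients `T_k` and `ρ_k`. -/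
noncomputable def stringDensity (T ρ : Fin 3 → ℝ → ℝ)
    (hT : ∀ k, MemLp (T k) ⊤ (volume.restrict (Ioo a b)))
    (hρ : ∀ k, MemLp (ρ k) ⊤ (volume.restrict (Ioo a b)))
    (h : ∃ ε : ℝ, 0 < ε ∧
      ∀ k, ∀ᵐ ζ ∂(volume.restrict (Ioo a b)), ε ≤ T k ζ ∧ ε ≤ ρ k ζ) :
    HamiltonianDensity a b (Fin 6) where
  toFun ζ := Matrix.diagonal fun i => (stringDiag T ρ ζ i : ℂ)
  aestronglyMeasurable := by
    have hm : ∀ i, AEStronglyMeasurable (fun ζ => stringDiag T ρ ζ i) (intervalMeasure a b) := by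
      intro i
      fin_cases i
      · exact (hρ 0).1.aemeasurable.inv.aestronglyMeasurable
      · exact (hT 0).1
      · exact (hρ 1).1.aemeasurable.inv.aestronglyMeasurable
      · exact (hT 1).1
      · exact (hρ 2).1.aemeasurable.inv.aestronglyMeasurable
      · exact (hT 2).1
    intro i j
    by_cases hij : i = j
    · subst hij
      simpa using Complex.continuous_ofReal.comp_aestronglyMeasurable (hm i)
    · simpa [Matrix.diagonal_apply_ne _ hij] using aestronglyMeasurable_const
  bounded := by
    obtain ⟨ε, hε, h⟩ := h
    choose CT hCT hT' using fun k => ae_le_of_memLp_top (hT k)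
    refine ⟨CT 0 + CT 1 + CT 2 + ε⁻¹, ?_⟩
    filter_upwards [ae_all_iff.2 h, ae_all_iff.2 hT'] with ζ h1 h2
    have hb : ∀ i, |stringDiag T ρ ζ i| ≤ CT 0 + CT 1 + CT 2 + ε⁻¹ := by
      have hr : ∀ k, |(ρ k ζ)⁻¹| ≤ ε⁻¹ := fun k => by
        rw [abs_of_pos (inv_pos.2 (hε.trans_le (h1 k).2))]
        exact inv_anti₀ hε (h1 k).2
      have hi := inv_pos.2 hε
      have := hCT 0
      have := hCT 1
      have := hCT 2
      have := h2 0
      have := h2 1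
      have := h2 2
      have := hr 0
      have := hr 1
      have := hr 2
      intro i
      fin_cases i
      · change |(ρ 0 ζ)⁻¹| ≤ _
        linarith
      · change |T 0 ζ| ≤ _
        linarith
      · change |(ρ 1 ζ)⁻¹| ≤ _
        linarith
      · change |T 1 ζ| ≤ _
        linarith
      · change |(ρ 2 ζ)⁻¹| ≤ _
        linarith
      · change |T 2 ζ| ≤ _
        linarith
    intro i j
    by_cases hij : i = j
    · subst hij
      simpa using hb i
    · simpa [Matrix.diagonal_apply_ne _ hij] using (abs_nonneg _).trans (hb i)
  isHermitian := by
    refine ae_of_all _ fun ζ => ?_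
    refine Matrix.isHermitian_diagonal_of_self_adjoint _ ?_
    ext i
    simp
  coercive := by
    obtain ⟨ε, hε, h⟩ := h
    choose C hC hρ' using fun k => ae_le_of_memLp_top (hρ k)
    have hpos : 0 < C 0 + C 1 + C 2 := by linarith [hC 0, hC 1, hC 2]
    refine ⟨min ε (C 0 + C 1 + C 2)⁻¹, lt_min hε (inv_pos.2 hpos), ?_⟩
    filter_upwards [ae_all_iff.2 h, ae_all_iff.2 hρ'] with ζ h1 h2
    have hr : ∀ k, (C 0 + C 1 + C 2)⁻¹ ≤ (ρ k ζ)⁻¹ := fun k => by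
      refine inv_anti₀ (hε.trans_le (h1 k).2) ((le_abs_self _).trans ((h2 k).trans ?_))
      fin_cases k <;> simp <;> linarith [hC 0, hC 1, hC 2]
    have hb : ∀ i, min ε (C 0 + C 1 + C 2)⁻¹ ≤ stringDiag T ρ ζ i := by
      intro i
      fin_cases i
      · exact (min_le_right _ _).trans (hr 0)
      · exact (min_le_left _ _).trans (h1 0).1
      · exact (min_le_right _ _).trans (hr 1)
      · exact (min_le_left _ _).trans (h1 1).1
      · exact (min_le_right _ _).trans (hr 2)
      · exact (min_le_left _ _).trans (h1 2).1
    rw [Matrix.smul_one_eq_diagonal, Matrix.diagonal_sub, Matrix.posSemidef_diagonal_iff]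
    intro i
    rw [← Complex.ofReal_sub]
    exact Complex.zero_le_real.2 (sub_nonneg.2 (hb i))

end Network

end PortHamiltonian

/-!
The proof rests on the Lumer–Phillips theorem at the point `0` of the resolvent set, where solving
`A x = f` needs only an integration and no differential equation: a dissipative operator `A` on a
Hilbert space that maps its domain bijectively onto the space generates a contraction semigroup
(`generatesContractionSemigroup_of_bijective`). The inverse `B` of such an `A` is dissipative and
defined everywhere, hence bounded (`IsDissipative.continuous`) and with dense range
(`IsDissipative.denseRange`). For `ε > 0` the operator `(B - ε)⁻¹`, a Yosida approximation of `A`,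
is bounded and dissipative, so that it generates contractions, and these converge strongly as `ε →
0` (`IsDissipative.exists_semigroup`).

For the port-Hamiltonian operator `A x = P (ℋ x)'`, the continuous representative of `ℋ x` is a
primitive of its weak derivative, by the lemma of du Bois-Reymond (`IsWeakDeriv.eq_primitive`).
Hence `Re ⟪A x, x⟫` is a difference of boundary terms (`re_integral_inner_matVec`), and `A x = f`
is solved by integration, `ℋ x = c + ∫ P⁻¹ f`, where the boundary conditions determine `c`.
Multiplication by `ℋ` is invertible on `L₂` because it is coercive (`effortMap_bijective`);
coercivity also makes the energy space complete. So generation reduces to linear algebra of the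
boundary matrix (`operator_generatesContractionSemigroup`). For the network of strings the
velocities at `b` agree and the forces there add up to `-β` times the velocity, while at `a`
either the velocity or the force of each string vanishes; `Re ⟪A x, x⟫` is therefore `-β / 2`
times the squared modulus of the common velocity (`stringW_dissipative`).
-/

namespace PortHamiltonian

/-! ### Dissipative operators and their exponentials -/

section Dissipative

variable {X : Type*} [NormedAddCommGroup X] [InnerProductSpace ℂ X]

/-- A linear map, defined on the whole space, with `Re ⟪B x, x⟫ ≤ 0` for all `x`. -/
def IsDissipative (B : X →ₗ[ℂ] X) : Prop :=
  ∀ x, (inner ℂ (B x) x).re ≤ 0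

/-- A dissipative map that is defined everywhere is bounded: if `u n → 0` and `B (u n) → z`, then
dissipativity at `u n + s • z` gives `‖z‖ ^ 2 ≤ 0` as `n → ∞` and then `s ↓ 0`, so the graph of `B`
is closed. -/
theorem IsDissipative.continuous [CompleteSpace X] {B : X →ₗ[ℂ] X} (hB : IsDissipative B) :
    Continuous B := by
  refine B.continuous_of_seq_closed_graph fun u x y hu hy => ?_
  set z := y - B x with hz
  have hv : Tendsto (fun n => u n - x) atTop (𝓝 0) := by
    simpa using hu.sub_const x
  have hBv : Tendsto (fun n => B (u n - x)) atTop (𝓝 z) := by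
    simpa [hz] using hy.sub_const (B x)
  have h1 : ∀ s : ℝ, 0 < s → (inner ℂ z z).re + s * (inner ℂ (B z) z).re ≤ 0 := by
    intro s hs
    have h2 : Tendsto (fun n => (inner ℂ (B (u n - x + (s : ℂ) • z)) (u n - x + (s : ℂ) • z)).re)
        atTop (𝓝 (inner ℂ (z + (s : ℂ) • B z) (0 + (s : ℂ) • z)).re) := by
      simp only [map_add, map_smul]
      exact (Complex.continuous_re.tendsto _).comp
        ((hBv.add_const _).inner (hv.add_const _))
    have h3 := le_of_tendsto' h2 fun n => hB _
    simp only [zero_add, inner_smul_right, inner_add_left, inner_smul_left, Complex.conj_ofReal,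
      Complex.re_ofReal_mul, Complex.add_re] at h3
    by_contra hcon
    push Not at hcon
    nlinarith [mul_pos hs hcon]
  have h4 : Tendsto (fun s : ℝ => (inner ℂ z z).re + s * (inner ℂ (B z) z).re) (𝓝[>] 0)
      (𝓝 ((inner ℂ z z).re + 0 * (inner ℂ (B z) z).re)) :=
    (Continuous.tendsto (by fun_prop) _).mono_left nhdsWithin_le_nhds
  have h5 : (inner ℂ z z).re + 0 * (inner ℂ (B z) z).re ≤ 0 :=
    le_of_tendsto h4 (eventually_mem_nhdsWithin.mono fun s hs => h1 s hs)
  have h6 : z = 0 := by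
    have h7 : (inner ℂ z z).re = ‖z‖ ^ 2 := inner_self_eq_norm_sq (𝕜 := ℂ) z
    have h8 : ‖z‖ ^ 2 = 0 := le_antisymm (by linarith) (by positivity)
    simpa using h8
  exact sub_eq_zero.1 h6

/-- A dissipative map and its adjoint have the same kernel; hence an injective one has dense
range. -/
theorem IsDissipative.denseRange [CompleteSpace X] {B : X →ₗ[ℂ] X} (hB : IsDissipative B)
    (hinj : Function.Injective B) : DenseRange B := by
  have h : (LinearMap.range B).topologicalClosure = ⊤ := by
    rw [Submodule.topologicalClosure_eq_top_iff, Submodule.eq_bot_iff]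
    intro x hx
    have hx' : ∀ y, inner ℂ (B y) x = 0 := fun y =>
      (Submodule.mem_orthogonal _ _).1 hx _ ⟨y, rfl⟩
    -- dissipativity at `x + s • B x`, for small `s > 0`, forces `‖B x‖ ^ 2 ≤ 0`
    have h1 : ∀ s : ℝ, 0 < s → ‖B x‖ ^ 2 + s * (inner ℂ (B (B x)) (B x)).re ≤ 0 := by
      intro s hs
      have h3 := hB (x + (s : ℂ) • B x)
      simp only [map_add, map_smul, inner_add_left, inner_add_right, inner_smul_left,
        inner_smul_right, hx', Complex.conj_ofReal, Complex.re_ofReal_mul, Complex.add_re,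
        mul_zero, zero_add] at h3
      have h7 : (inner ℂ (B x) (B x)).re = ‖B x‖ ^ 2 := inner_self_eq_norm_sq (𝕜 := ℂ) _
      rw [h7] at h3
      by_contra hcon
      push Not at hcon
      nlinarith [mul_pos hs hcon]
    have h4 : Tendsto (fun s : ℝ => ‖B x‖ ^ 2 + s * (inner ℂ (B (B x)) (B x)).re) (𝓝[>] 0)
        (𝓝 (‖B x‖ ^ 2 + 0 * (inner ℂ (B (B x)) (B x)).re)) :=
      (Continuous.tendsto (by fun_prop) _).mono_left nhdsWithin_le_nhds
    have h5 : ‖B x‖ ^ 2 + 0 * (inner ℂ (B (B x)) (B x)).re ≤ 0 :=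
      le_of_tendsto h4 (eventually_mem_nhdsWithin.mono fun s hs => h1 s hs)
    have h8 : ‖B x‖ ^ 2 = 0 := le_antisymm (by linarith) (by positivity)
    have h9 : B x = 0 := by simpa using h8
    exact hinj (h9.trans (map_zero B).symm)
  rw [DenseRange, dense_iff_closure_eq]
  have h1 := congrArg (fun K : Submodule ℂ X => (K : Set X)) h
  rwa [Submodule.topologicalClosure_coe, LinearMap.coe_range] at h1

/-- For `ε > 0` the operator `C = (B - ε)⁻¹` is bounded and dissipative. It is the Yosida
approximation, with parameter `1 / ε`, of the inverse of `B`. It commutes with all operators that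
commute with `B`, so these approximations commute with each other. -/
theorem IsDissipative.exists_yosida [CompleteSpace X] {B : X →L[ℂ] X}
    (hB : IsDissipative (B : X →ₗ[ℂ] X)) {ε : ℝ} (hε : 0 < ε) :
    ∃ C : X →L[ℂ] X, IsDissipative (C : X →ₗ[ℂ] X) ∧ (∀ x, C (B x) = x + (ε : ℂ) • C x) ∧
      (∀ x, ‖(ε : ℂ) • C x‖ ≤ ‖x‖) ∧ ∀ S : X →L[ℂ] X, Commute S B → Commute S C := by
  set U : X →L[ℂ] X := (ε : ℂ) • 1 - B with hU
  have hre : ∀ x, ε * ‖x‖ ^ 2 ≤ (inner ℂ (U x) x).re := by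
    intro x
    have h1 := hB x
    simp only [ContinuousLinearMap.coe_coe] at h1
    have h7 : (inner ℂ x x).re = ‖x‖ ^ 2 := inner_self_eq_norm_sq (𝕜 := ℂ) x
    simp only [hU, sub_apply, smul_apply,
      one_apply_eq_self, inner_sub_left, inner_smul_left, Complex.conj_ofReal,
      Complex.sub_re, Complex.re_ofReal_mul, h7]
    linarith
  have hunit : IsUnit U := by
    refine ContinuousLinearMap.isUnit_of_forall_le_norm_inner_map U (c := ⟨ε, hε.le⟩) hε
      fun x => ?_
    rw [mul_comm]
    exact (hre x).trans (Complex.re_le_norm _)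
  obtain ⟨u, hu⟩ := hunit
  set D : X →L[ℂ] X := ((u⁻¹ : (X →L[ℂ] X)ˣ) : X →L[ℂ] X) with hD
  have hUD : ∀ x, U (D x) = x := fun x => by
    have : U * D = 1 := by rw [← hu, hD, Units.mul_inv]
    exact congrArg (fun F : X →L[ℂ] X => F x) this
  have hDU : ∀ x, D (U x) = x := fun x => by
    have : D * U = 1 := by rw [← hu, hD, Units.inv_mul]
    exact congrArg (fun F : X →L[ℂ] X => F x) this
  refine ⟨-D, fun x => ?_, fun x => ?_, fun x => ?_, fun S hS => ?_⟩
  · have h1 := hre (D x)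
    rw [hUD] at h1
    have h2 : (inner ℂ (D x) x).re = (inner ℂ x (D x)).re := inner_re_symm (𝕜 := ℂ) _ _
    have h3 : 0 ≤ ε * ‖D x‖ ^ 2 := by positivity
    simp only [ContinuousLinearMap.coe_coe, neg_apply, inner_neg_left,
      Complex.neg_re, h2]
    linarith
  · have h1 := hDU x
    simp only [hU, sub_apply, smul_apply,
      one_apply_eq_self, map_sub, map_smul] at h1
    rw [neg_apply, neg_apply, smul_neg]
    nth_rewrite 2 [← h1]
    abel
  · have h1 := hre (D x)
    rw [hUD] at h1
    have h2 := h1.trans ((Complex.re_le_norm _).trans (norm_inner_le_norm _ _))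
    rw [norm_smul, neg_apply, norm_neg, Complex.norm_real,
      Real.norm_of_nonneg hε.le]
    rcases (norm_nonneg (D x)).eq_or_lt with h0 | h0
    · rw [← h0, mul_zero]
      positivity
    · exact le_of_mul_le_mul_right (by linarith [pow_two ‖D x‖]) h0
  · have h1 : Commute S (u : X →L[ℂ] X) := by
      rw [hu, hU]
      exact ((Commute.one_right S).smul_right _).sub_right hS
    exact h1.units_inv_right.neg_right

/-- The group `exp (t C)` generated by a bounded operator `C`. -/
noncomputable def expGroup (C : X →L[ℂ] X) (t : ℝ) : X →L[ℂ] X :=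
  NormedSpace.exp ((t : ℂ) • C)

theorem expGroup_zero (C : X →L[ℂ] X) : expGroup C 0 = 1 := by
  simp [expGroup]

variable [CompleteSpace X]

theorem expGroup_add (C : X →L[ℂ] X) (s t : ℝ) :
    expGroup C (s + t) = expGroup C s * expGroup C t := by
  let _ : NormedAlgebra ℚ (X →L[ℂ] X) := NormedAlgebra.restrictScalars ℚ ℂ _
  rw [expGroup, Complex.ofReal_add, add_smul,
    NormedSpace.exp_add_of_commute (((Commute.refl C).smul_left _).smul_right _)]
  rfl

theorem hasDerivAt_expGroup (C : X →L[ℂ] X) (x : X) (t : ℝ) :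
    HasDerivAt (fun s => expGroup C s x) (expGroup C t (C x)) t := by
  have h := (hasDerivAt_exp_smul_const (𝕂 := ℂ) C (t : ℂ)).scomp t
    (Complex.ofRealCLM.hasDerivAt (x := t))
  rw [Complex.ofRealCLM_apply, Complex.ofReal_one, one_smul] at h
  exact (((ContinuousLinearMap.apply ℂ X x).restrictScalars ℝ).hasFDerivAt.comp_hasDerivAt t h :)

theorem expGroup_comm (C : X →L[ℂ] X) (t : ℝ) (x : X) :
    expGroup C t (C x) = C (expGroup C t x) := by
  let _ : NormedAlgebra ℚ (X →L[ℂ] X) := NormedAlgebra.restrictScalars ℚ ℂ _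
  have h : Commute (expGroup C t) C := ((Commute.refl C).smul_left _).exp_left
  exact congrArg (fun F : X →L[ℂ] X => F x) h.eq

/-- `‖exp (t C) x‖ ^ 2` has the derivative `2 Re ⟪C u, u⟫` at `u = exp (t C) x`. -/
theorem norm_expGroup_apply_le {C : X →L[ℂ] X} (hC : IsDissipative (C : X →ₗ[ℂ] X)) {t : ℝ}
    (ht : 0 ≤ t) (x : X) : ‖expGroup C t x‖ ≤ ‖x‖ := by
  have hd : ∀ s, HasDerivAt (fun s => (inner ℂ (expGroup C s x) (expGroup C s x)).re)
      (2 * (inner ℂ (C (expGroup C s x)) (expGroup C s x)).re) s := by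
    intro s
    have h1 := hasDerivAt_expGroup C x s
    rw [expGroup_comm] at h1
    have h2 := (Complex.reCLM.hasFDerivAt.comp_hasDerivAt s (h1.inner ℂ h1) :)
    refine h2.congr_deriv ?_
    have h3 : (inner ℂ (expGroup C s x) (C (expGroup C s x))).re =
      (inner ℂ (C (expGroup C s x)) (expGroup C s x)).re := inner_re_symm (𝕜 := ℂ) _ _
    simp only [Complex.reCLM_apply, Complex.add_re, h3]
    ring
  have hanti : Antitone fun s => (inner ℂ (expGroup C s x) (expGroup C s x)).re := by
    refine antitone_of_deriv_nonpos (fun s => (hd s).differentiableAt) fun s => ?_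
    rw [(hd s).deriv]
    exact mul_nonpos_of_nonneg_of_nonpos zero_le_two (hC (expGroup C s x))
  have h := hanti ht
  have h7 : ∀ y : X, (inner ℂ y y).re = ‖y‖ ^ 2 := inner_self_eq_norm_sq (𝕜 := ℂ)
  simp only [h7, expGroup_zero, one_apply_eq_self] at h
  exact le_of_sq_le_sq h (norm_nonneg _)

/-- The interpolation `s ↦ exp ((t - s) C') exp (s C) x` has the derivative
`exp ((t - s) C') exp (s C) (C x - C' x)`. -/
theorem norm_expGroup_sub_expGroup_le {C C' : X →L[ℂ] X} (hC : IsDissipative (C : X →ₗ[ℂ] X))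
    (hC' : IsDissipative (C' : X →ₗ[ℂ] X)) (hcomm : Commute C C') {t : ℝ} (ht : 0 ≤ t) (x : X) :
    ‖expGroup C t x - expGroup C' t x‖ ≤ ‖C x - C' x‖ * t := by
  let _ : NormedAlgebra ℚ (X →L[ℂ] X) := NormedAlgebra.restrictScalars ℚ ℂ _
  have hfac : ∀ s : ℝ, expGroup C' t * expGroup (C - C') s =
      expGroup C' (t - s) * expGroup C s := by
    intro s
    rw [expGroup, expGroup, expGroup, expGroup, ← NormedSpace.exp_add_of_commute,
      ← NormedSpace.exp_add_of_commute]
    · congr 1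
      push_cast
      module
    · exact (hcomm.symm.smul_left _).smul_right _
    · exact ((hcomm.symm.sub_right (Commute.refl _)).smul_left _).smul_right _
  have hd : ∀ s ∈ Icc (0 : ℝ) t, HasDerivWithinAt
      (fun s => expGroup C' t (expGroup (C - C') s x))
      (expGroup C' t (expGroup (C - C') s ((C - C') x))) (Icc 0 t) s := fun s _ =>
    (((expGroup C' t).restrictScalars ℝ).hasFDerivAt.comp_hasDerivAt s
      (hasDerivAt_expGroup (C - C') x s) :).hasDerivWithinAt
  have hb : ∀ s ∈ Ico (0 : ℝ) t,
      ‖expGroup C' t (expGroup (C - C') s ((C - C') x))‖ ≤ ‖C x - C' x‖ := by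
    intro s hs
    rw [← mul_apply_eq_comp, hfac, mul_apply_eq_comp]
    exact (norm_expGroup_apply_le hC' (by linarith [hs.2]) _).trans
      (norm_expGroup_apply_le hC hs.1 _)
  have h := norm_image_sub_le_of_norm_deriv_le_segment' hd hb t (right_mem_Icc.2 ht)
  have h1 : expGroup C' t (expGroup (C - C') t x) = expGroup C t x := by
    rw [← mul_apply_eq_comp, hfac, sub_self, expGroup_zero, one_mul]
  rw [h1, expGroup_zero, sub_zero] at h
  exact h

theorem norm_expGroup_sub_self_le {C : X →L[ℂ] X} (hC : IsDissipative (C : X →ₗ[ℂ] X)) {t : ℝ}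
    (ht : 0 ≤ t) (x : X) : ‖expGroup C t x - x‖ ≤ ‖C x‖ * t := by
  have h0 : IsDissipative ((0 : X →L[ℂ] X) : X →ₗ[ℂ] X) := fun x => by simp
  have h := norm_expGroup_sub_expGroup_le hC h0 (Commute.zero_right C) ht x
  simpa [expGroup] using h

/-- The remainder of the first-order expansion of `exp (t C) x` in `t`, bounded by the oscillation
of its derivative `exp (s C) (C x)`. -/
theorem norm_expGroup_sub_self_sub_le (C : X →L[ℂ] X) {t K : ℝ} (ht : 0 ≤ t) (x : X)
    (hK : ∀ s ∈ Icc 0 t, ‖expGroup C s (C x) - C x‖ ≤ K) :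
    ‖expGroup C t x - x - (t : ℂ) • C x‖ ≤ K * t := by
  have hd : ∀ s ∈ Icc (0 : ℝ) t, HasDerivWithinAt
      (fun s : ℝ => expGroup C s x - (s : ℂ) • C x)
      (expGroup C s (C x) - C x) (Icc 0 t) s := by
    intro s _
    have h1 : HasDerivAt (fun s : ℝ => (s : ℂ) • C x) ((1 : ℂ) • C x) s :=
      (Complex.ofRealCLM.hasDerivAt (x := s)).smul_const (C x)
    rw [one_smul] at h1
    exact ((hasDerivAt_expGroup C x s).sub h1).hasDerivWithinAt
  have h := norm_image_sub_le_of_norm_deriv_le_segment' hd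
    (fun s hs => hK s (Ico_subset_Icc_self hs)) t (right_mem_Icc.2 ht)
  simp only [expGroup_zero, one_apply_eq_self, Complex.ofReal_zero, zero_smul,
    sub_zero] at h
  rwa [sub_right_comm]

end Dissipative

/-! ### Generation of contraction semigroups -/

section Generation

variable {X : Type*} [NormedAddCommGroup X] [InnerProductSpace ℂ X] [CompleteSpace X]

/-- The semigroup generated by `B⁻¹` is the strong limit, as `ε → 0`, of the groups
`exp (t (B - ε)⁻¹)`. -/
theorem IsDissipative.exists_semigroup {B : X →L[ℂ] X}
    (hB : IsDissipative (B : X →ₗ[ℂ] X)) (hinj : Function.Injective B) :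
    ∃ T : ℝ≥0 → X →L[ℂ] X, IsContractionSemigroup T ∧
      ∀ y, Tendsto (fun t : ℝ≥0 => (((t : ℝ) : ℂ)⁻¹) • (T t (B y) - B y)) (𝓝[>] 0) (𝓝 y) := by
  have hdense : ∀ x : X, ∀ δ > 0, ∃ z, ‖x - B z‖ < δ := fun x δ hδ => by
    obtain ⟨z, hz⟩ := (hB.denseRange hinj).exists_dist_lt x hδ
    exact ⟨z, by simpa [dist_eq_norm] using hz⟩
  set ε : ℕ → ℝ := fun n => 1 / ((n : ℝ) + 1) with hεdef
  have hε : ∀ n, 0 < ε n := fun n => Nat.one_div_pos_of_nat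
  have hε0 : Tendsto ε atTop (𝓝 0) := tendsto_one_div_add_atTop_nhds_zero_nat
  choose C hC hCB hCle hCcomm using fun n => hB.exists_yosida (hε n)
  have hcomm : ∀ m n, Commute (C m) (C n) := fun m n =>
    hCcomm n _ (hCcomm m _ (Commute.refl B)).symm
  have hCBle : ∀ n z, ‖C n (B z)‖ ≤ 2 * ‖z‖ := fun n z => by
    rw [hCB]
    linarith [norm_add_le z ((ε n : ℂ) • C n z), hCle n z]
  have hεC : ∀ z, Tendsto (fun n => (ε n : ℂ) • C n z) atTop (𝓝 0) := by
    intro z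
    rw [Metric.tendsto_atTop]
    intro δ hδ
    obtain ⟨w, hw⟩ := hdense z (δ / 2) (half_pos hδ)
    have h1 : Tendsto (fun n => ε n * (2 * ‖w‖)) atTop (𝓝 0) := by
      simpa using hε0.mul_const (2 * ‖w‖)
    obtain ⟨N, hN⟩ := eventually_atTop.1 (h1.eventually_lt_const (half_pos hδ))
    refine ⟨N, fun n hn => ?_⟩
    have h2 : (ε n : ℂ) • C n z = (ε n : ℂ) • C n (z - B w) + (ε n : ℂ) • C n (B w) := by
      rw [← smul_add, ← map_add, sub_add_cancel]
    have h3 : ‖(ε n : ℂ) • C n (B w)‖ ≤ ε n * (2 * ‖w‖) := by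
      rw [norm_smul, Complex.norm_real, Real.norm_of_nonneg (hε n).le]
      exact mul_le_mul_of_nonneg_left (hCBle n w) (hε n).le
    rw [dist_zero_right, h2]
    linarith [norm_add_le ((ε n : ℂ) • C n (z - B w)) ((ε n : ℂ) • C n (B w)),
      hCle n (z - B w), hN n hn]
  have hCBlim : ∀ z, Tendsto (fun n => C n (B z)) atTop (𝓝 z) := fun z => by
    simpa [hCB] using (hεC z).const_add z
  have hcauchy : ∀ (t : ℝ≥0) (x : X), CauchySeq fun n => expGroup (C n) t x := by
    intro t x
    rw [Metric.cauchySeq_iff]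
    intro δ hδ
    obtain ⟨z, hz⟩ := hdense x (δ / 3) (by positivity)
    have hz' := (hCBlim z).cauchySeq
    rw [Metric.cauchySeq_iff] at hz'
    obtain ⟨N, hN⟩ := hz' (δ / 3 / ((t : ℝ) + 1)) (by positivity)
    refine ⟨N, fun m hm n hn => ?_⟩
    have h1 := norm_expGroup_sub_expGroup_le (hC m) (hC n) (hcomm m n) t.coe_nonneg (B z)
    have h2 := hN m hm n hn
    rw [dist_eq_norm, lt_div_iff₀ (by positivity)] at h2
    have h3 := norm_expGroup_apply_le (hC m) t.coe_nonneg (x - B z)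
    have h4 := norm_expGroup_apply_le (hC n) t.coe_nonneg (x - B z)
    have h5 : expGroup (C m) t x - expGroup (C n) t x =
        expGroup (C m) t (x - B z) + (expGroup (C m) t (B z) - expGroup (C n) t (B z)) -
          expGroup (C n) t (x - B z) := by
      simp only [map_sub]
      abel
    rw [dist_eq_norm, h5]
    refine (norm_sub_le _ _).trans_lt ?_
    have h6 := norm_add_le (expGroup (C m) t (x - B z))
      (expGroup (C m) t (B z) - expGroup (C n) t (B z))
    have h7 : ‖C m (B z) - C n (B z)‖ * (t : ℝ) ≤ ‖C m (B z) - C n (B z)‖ * ((t : ℝ) + 1) :=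
      mul_le_mul_of_nonneg_left (by linarith) (norm_nonneg _)
    linarith
  choose S hS using fun (t : ℝ≥0) (x : X) => cauchySeq_tendsto_of_complete (hcauchy t x)
  have hSle : ∀ t x, ‖S t x‖ ≤ ‖x‖ := fun t x =>
    le_of_tendsto' (hS t x).norm fun n => norm_expGroup_apply_le (hC n) t.coe_nonneg x
  set T : ℝ≥0 → X →L[ℂ] X := fun t => LinearMap.mkContinuous
    (linearMapOfTendsto (l := atTop) (S t) (fun n => (expGroup (C n) t : X →ₗ[ℂ] X))
      (tendsto_pi_nhds.2 (hS t))) 1 (fun x => by simpa using hSle t x) with hT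
  have hTS : ∀ t x, T t x = S t x := fun t x => rfl
  -- `x` is near some `B z`, on which the approximating groups are Lipschitz in time, uniformly
  have hnear : ∀ n (t : ℝ), 0 ≤ t → ∀ x z,
      ‖expGroup (C n) t x - x‖ ≤ 2 * ‖x - B z‖ + 2 * ‖z‖ * t := by
    intro n t ht x z
    have h1 := norm_expGroup_sub_self_le (hC n) ht (B z)
    have h2 := norm_expGroup_apply_le (hC n) ht (x - B z)
    have h3 : expGroup (C n) t x - x =
        expGroup (C n) t (x - B z) + (expGroup (C n) t (B z) - B z) - (x - B z) := by
      simp only [map_sub]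
      abel
    have h4 := norm_add_le (expGroup (C n) t (x - B z)) (expGroup (C n) t (B z) - B z)
    have h5 := mul_le_mul_of_nonneg_right (hCBle n z) ht
    rw [h3]
    linarith [norm_sub_le (expGroup (C n) t (x - B z) + (expGroup (C n) t (B z) - B z)) (x - B z)]
  have hT1 : ∀ (t : ℝ≥0) x z, ‖T t x - x‖ ≤ 2 * ‖x - B z‖ + 2 * ‖z‖ * t := fun t x z =>
    le_of_tendsto' ((hS t x).sub_const x).norm fun n => hnear n t t.coe_nonneg x z
  have hT2 : ∀ (t : ℝ≥0) y z, ‖T t (B y) - B y - ((t : ℝ) : ℂ) • y‖ ≤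
      (2 * ‖y - B z‖ + 2 * ‖z‖ * t) * t := by
    intro t y z
    have hlim : Tendsto
        (fun n => expGroup (C n) t (B y) - B y - ((t : ℝ) : ℂ) • C n (B y)) atTop
        (𝓝 (T t (B y) - B y - ((t : ℝ) : ℂ) • y)) :=
      ((hS t (B y)).sub_const _).sub ((hCBlim y).const_smul _)
    have hr : Tendsto (fun n => (2 * ‖y - B z‖ + 2 * ‖z‖ * (t : ℝ) + 2 * ‖C n (B y) - y‖) * (t : ℝ))
        atTop (𝓝 ((2 * ‖y - B z‖ + 2 * ‖z‖ * (t : ℝ) + 2 * ‖y - y‖) * (t : ℝ))) :=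
      ((((hCBlim y).sub_const y).norm.const_mul 2).const_add _).mul_const _
    rw [sub_self, norm_zero, mul_zero, add_zero] at hr
    refine le_of_tendsto_of_tendsto' hlim.norm hr fun n =>
      norm_expGroup_sub_self_sub_le (C n) t.coe_nonneg (B y) fun s hs => ?_
    have h1 := hnear n s hs.1 y z
    have h2 := norm_expGroup_apply_le (hC n) hs.1 (C n (B y) - y)
    have h3 : expGroup (C n) s (C n (B y)) - C n (B y) =
        expGroup (C n) s (C n (B y) - y) + (expGroup (C n) s y - y) - (C n (B y) - y) := by
      simp only [map_sub]
      abel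
    have h4 : 2 * ‖z‖ * s ≤ 2 * ‖z‖ * t := mul_le_mul_of_nonneg_left hs.2 (by positivity)
    rw [h3]
    linarith [norm_sub_le (expGroup (C n) s (C n (B y) - y) + (expGroup (C n) s y - y))
      (C n (B y) - y), norm_add_le (expGroup (C n) s (C n (B y) - y)) (expGroup (C n) s y - y)]
  have hcoe : Tendsto (fun t : ℝ≥0 => (t : ℝ)) (𝓝[>] 0) (𝓝 0) := by
    simpa using (NNReal.continuous_coe.tendsto 0).mono_left nhdsWithin_le_nhds
  have hsmall : ∀ x : X, ∀ δ > 0, ∃ z, ∀ᶠ t : ℝ≥0 in 𝓝[>] 0,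
      2 * ‖x - B z‖ + 2 * ‖z‖ * t < δ := by
    intro x δ hδ
    obtain ⟨z, hz⟩ := hdense x (δ / 4) (by positivity)
    have h1 : Tendsto (fun t : ℝ≥0 => 2 * ‖z‖ * (t : ℝ)) (𝓝[>] 0) (𝓝 0) := by
      simpa using hcoe.const_mul (2 * ‖z‖)
    refine ⟨z, (h1.eventually_lt_const (half_pos hδ)).mono fun t ht => ?_⟩
    linarith
  refine ⟨T, ⟨?_, ?_, ?_, ?_⟩, ?_⟩
  · ext x
    have h : Tendsto (fun n => expGroup (C n) ((0 : ℝ≥0) : ℝ) x) atTop (𝓝 x) := by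
      simp [expGroup_zero]
    exact tendsto_nhds_unique (hS 0 x) h
  · intro s t
    ext x
    have h1 : Tendsto (fun n => expGroup (C n) s (expGroup (C n) t x - S t x)) atTop (𝓝 0) := by
      refine squeeze_zero_norm (fun n => norm_expGroup_apply_le (hC n) s.coe_nonneg _) ?_
      simpa using ((hS t x).sub_const (S t x)).norm
    have h2 := h1.add (hS s (S t x))
    simp only [map_sub, sub_add_cancel, zero_add] at h2
    refine tendsto_nhds_unique (hS (s + t) x) (h2.congr fun n => ?_)
    rw [NNReal.coe_add, expGroup_add]
    rfl
  · intro x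
    rw [Metric.tendsto_nhds]
    intro δ hδ
    obtain ⟨z, hz⟩ := hsmall x δ hδ
    refine hz.mono fun t ht => ?_
    rw [dist_eq_norm]
    exact (hT1 t x z).trans_lt ht
  · exact fun t => LinearMap.mkContinuous_norm_le _ zero_le_one _
  · intro y
    rw [Metric.tendsto_nhds]
    intro δ hδ
    obtain ⟨z, hz⟩ := hsmall y δ hδ
    filter_upwards [hz, eventually_mem_nhdsWithin] with t ht ht0
    have ht0' : (0 : ℝ) < t := ht0
    have ht1 : ((t : ℝ) : ℂ) ≠ 0 := Complex.ofReal_ne_zero.2 ht0'.ne'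
    have h1 : (((t : ℝ) : ℂ)⁻¹) • (T t (B y) - B y) - y =
        (((t : ℝ) : ℂ)⁻¹) • (T t (B y) - B y - ((t : ℝ) : ℂ) • y) := by
      rw [smul_sub _ (T t (B y) - B y), inv_smul_smul₀ ht1]
    rw [dist_eq_norm, h1, norm_smul, norm_inv, Complex.norm_real, Real.norm_of_nonneg ht0'.le,
      inv_mul_lt_iff₀ ht0', mul_comm]
    exact (hT2 t y z).trans_lt (mul_lt_mul_of_pos_right ht ht0')

/-- A dissipative operator on a Hilbert space that maps its domain bijectively onto the space
generates a contraction semigroup. This is the Lumer–Phillips theorem for an operator with `0` in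
its resolvent set. -/
theorem generatesContractionSemigroup_of_bijective (A : X →ₗ.[ℂ] X)
    (hdiss : ∀ x : A.domain, (inner ℂ (A x) (x : X)).re ≤ 0)
    (hinj : ∀ x : A.domain, A x = 0 → x = 0) (hsurj : ∀ y, ∃ x : A.domain, A x = y) :
    GeneratesContractionSemigroup A := by
  have hbij : Function.Bijective A.toFun :=
    ⟨(injective_iff_map_eq_zero A.toFun).2 hinj, hsurj⟩
  set e := LinearEquiv.ofBijective A.toFun hbij with he
  have hAe : ∀ y, A (e.symm y) = y := fun y => e.apply_symm_apply y
  set B₀ : X →ₗ[ℂ] X := A.domain.subtype ∘ₗ (e.symm : X →ₗ[ℂ] A.domain) with hB₀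
  have hB₀d : IsDissipative B₀ := by
    intro y
    have h := hdiss (e.symm y)
    rw [hAe] at h
    have h2 : (inner ℂ (B₀ y) y).re = (inner ℂ y (B₀ y)).re := inner_re_symm (𝕜 := ℂ) _ _
    rw [h2]
    exact h
  set B : X →L[ℂ] X := ⟨B₀, hB₀d.continuous⟩ with hBdef
  have hB : IsDissipative (B : X →ₗ[ℂ] X) := hB₀d
  have hBinj : Function.Injective B := Subtype.val_injective.comp e.symm.injective
  have hgraph : ∀ x y, (x, y) ∈ A.graph ↔ x = B y := by
    intro x y
    rw [LinearPMap.mem_graph_iff]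
    constructor
    · rintro ⟨u, hu, hAu⟩
      have : e.symm y = u := by
        rw [LinearEquiv.symm_apply_eq]
        exact hAu.symm
      exact hu.symm.trans (congrArg Subtype.val this.symm)
    · intro h
      exact ⟨e.symm y, h.symm, hAe y⟩
  obtain ⟨T, hT, hTB⟩ := hB.exists_semigroup hBinj
  refine ⟨T, hT, fun x y => ?_⟩
  rw [hgraph]
  refine ⟨fun h => h ▸ hTB y, fun h => ?_⟩
  -- `1 - A` is onto, so it maps some `B z` to `x - y`; dissipativity of `T` gives `x = B z`
  obtain ⟨C, -, hCB, -, hCcomm⟩ := hB.exists_yosida one_pos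
  set z := C (x - y) with hz
  have hBz : B z = x - y + z := by
    have h1 : B (C (x - y)) = C (B (x - y)) :=
      congrArg (fun F : X →L[ℂ] X => F (x - y)) (hCcomm B (Commute.refl B)).eq
    rw [hz, h1, hCB, Complex.ofReal_one, one_smul]
  set w := x - B z with hw
  have hwz : y - z = w := by
    rw [hw, hBz]
    abel
  have hTw : Tendsto (fun t : ℝ≥0 => (((t : ℝ) : ℂ)⁻¹) • (T t w - w)) (𝓝[>] 0) (𝓝 w) := by
    have h1 := h.sub (hTB z)
    rw [hwz] at h1
    refine h1.congr fun t => ?_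
    rw [← smul_sub, hw, map_sub]
    congr 1
    abel
  have h2 : ∀ t : ℝ≥0, (inner ℂ ((((t : ℝ) : ℂ)⁻¹) • (T t w - w)) w).re ≤ 0 := by
    intro t
    rw [← Complex.ofReal_inv, inner_smul_left, Complex.conj_ofReal, Complex.re_ofReal_mul]
    refine mul_nonpos_of_nonneg_of_nonpos (inv_nonneg.2 t.coe_nonneg) ?_
    have h3 : (inner ℂ w w).re = ‖w‖ ^ 2 := inner_self_eq_norm_sq (𝕜 := ℂ) w
    have h4 : (inner ℂ (T t w) w).re ≤ ‖w‖ ^ 2 := by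
      refine (Complex.re_le_norm _).trans ((norm_inner_le_norm _ _).trans ?_)
      rw [pow_two]
      refine mul_le_mul_of_nonneg_right ?_ (norm_nonneg _)
      simpa using (T t).le_of_opNorm_le (hT.contraction t) w
    rw [inner_sub_left, Complex.sub_re, h3]
    linarith
  have h5 : (inner ℂ w w).re ≤ 0 :=
    le_of_tendsto' ((Complex.continuous_re.tendsto _).comp (hTw.inner tendsto_const_nhds)) h2
  have h3 : (inner ℂ w w).re = ‖w‖ ^ 2 := inner_self_eq_norm_sq (𝕜 := ℂ) w
  have h6 : w = 0 := by
    have h8 : ‖w‖ ^ 2 = 0 := le_antisymm (by linarith) (by positivity)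
    simpa using h8
  have h7 : y = z := sub_eq_zero.1 (hwz.trans h6)
  rw [h7]
  exact sub_eq_zero.1 h6

end Generation

/-! ### Primitives and weak derivatives -/

section Primitive

theorem intervalIntegrable_of_integrable {E : Type*} [NormedAddCommGroup E] {a b x : ℝ}
    {g : ℝ → E} (hg : Integrable g (intervalMeasure a b)) (hx : x ∈ Icc a b) :
    IntervalIntegrable g volume a x := by
  rw [intervalIntegrable_iff_integrableOn_Ioo_of_le hx.1]
  exact IntegrableOn.mono_set (t := Ioo a b) hg (Ioo_subset_Ioo_right hx.2)

theorem continuousOn_primitive {E : Type*} [NormedAddCommGroup E] [NormedSpace ℝ E] {a b : ℝ}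
    (hab : a ≤ b) {g : ℝ → E} (hg : Integrable g (intervalMeasure a b)) :
    ContinuousOn (fun x => ∫ y in a..x, g y) (Icc a b) := by
  have h := intervalIntegral.continuousOn_primitive_interval (μ := volume) (f := g) (a := a)
    (b := b) ?_
  · rwa [uIcc_of_le hab] at h
  · rw [uIcc_of_le hab, integrableOn_Icc_iff_integrableOn_Ioo]
    exact hg

/-- The part of the integral of `h` over `(a,b)` to the left of `x`, as a primitive. -/
theorem integral_ite_le {E : Type*} [NormedAddCommGroup E] [NormedSpace ℝ E] {a b x : ℝ}
    (hx : x ∈ Ioo a b) (h : ℝ → E) :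
    ∫ y in Ioo a b, (if y ≤ x then h y else 0) = ∫ y in a..x, h y := by
  have e : (fun y => if y ≤ x then h y else 0) = (Iic x).indicator h := by
    ext y
    simp [indicator]
  rw [e, setIntegral_indicator measurableSet_Iic, intervalIntegral.integral_of_le hx.1.le]
  congr 2
  ext y
  simp only [mem_inter_iff, mem_Ioo, mem_Iic, mem_Ioc]
  exact ⟨fun h => ⟨h.1.1, h.2⟩, fun h => ⟨⟨h.1, h.2.trans_lt hx.2⟩, h.2⟩⟩

theorem integral_ite_lt {E : Type*} [NormedAddCommGroup E] [NormedSpace ℝ E] {a b x : ℝ}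
    (hx : x ∈ Ioo a b) (h : ℝ → E) :
    ∫ y in Ioo a b, (if y < x then h y else 0) = ∫ y in a..x, h y := by
  rw [← integral_ite_le hx h]
  refine integral_congr_ae ?_
  filter_upwards [ae_restrict_of_ae (Measure.ae_ne volume x)] with y hy
  simp only [lt_iff_le_and_ne, hy, ne_eq, not_false_eq_true, and_true]

/-- Integration by parts for the primitives of two integrable functions: both sides integrate
`f x • g y` over the square `(a,b)²`, the left one separately over `y ≤ x` and `x < y`. -/
theorem integral_smul_primitive_add {𝕜 E : Type*} [RCLike 𝕜] [NormedAddCommGroup E]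
    [NormedSpace ℝ E] [NormedSpace 𝕜 E] [CompleteSpace E] {a b : ℝ} {f : ℝ → 𝕜} {g : ℝ → E}
    (hf : Integrable f (intervalMeasure a b)) (hg : Integrable g (intervalMeasure a b)) :
    (∫ x in Ioo a b, f x • ∫ y in a..x, g y) + ∫ x in Ioo a b, (∫ y in a..x, f y) • g x =
      (∫ x in Ioo a b, f x) • ∫ x in Ioo a b, g x := by
  set μ := intervalMeasure a b
  have hfg : Integrable (fun p : ℝ × ℝ => f p.1 • g p.2) (μ.prod μ) := hf.smul_prod hg
  have hK : Integrable (Function.uncurry fun x y => if y ≤ x then f x • g y else 0)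
      (μ.prod μ) := by
    refine (hfg.indicator (measurableSet_le measurable_snd measurable_fst)).congr
      (ae_of_all _ fun p => ?_)
    simp [indicator, Function.uncurry]
  have hK' : Integrable (Function.uncurry fun x y => if x < y then f x • g y else 0)
      (μ.prod μ) := by
    refine (hfg.indicator (measurableSet_lt measurable_fst measurable_snd)).congr
      (ae_of_all _ fun p => ?_)
    simp [indicator, Function.uncurry]
  have h1 : ∫ x, ∫ y, (if y ≤ x then f x • g y else 0) ∂μ ∂μ =
      ∫ x in Ioo a b, f x • ∫ y in a..x, g y := by
    refine setIntegral_congr_fun measurableSet_Ioo fun x hx => ?_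
    rw [← intervalIntegral.integral_smul]
    exact integral_ite_le hx fun y => f x • g y
  have h2 : ∫ x, ∫ y, (if x < y then f x • g y else 0) ∂μ ∂μ =
      ∫ x in Ioo a b, (∫ y in a..x, f y) • g x := by
    rw [integral_integral_swap hK']
    refine setIntegral_congr_fun measurableSet_Ioo fun x hx => ?_
    rw [← intervalIntegral.integral_smul_const]
    exact integral_ite_lt hx fun y => f y • g x
  rw [← h1, ← h2, ← integral_smul_const]
  refine (integral_add hK.integral_prod_left hK'.integral_prod_left).symm.trans ?_
  refine integral_congr_ae ?_
  filter_upwards [hK.prod_right_ae, hK'.prod_right_ae] with x hx hx'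
  refine (integral_add hx hx').symm.trans ?_
  rw [← integral_smul]
  refine integral_congr_ae (ae_of_all _ fun y => ?_)
  rcases le_or_gt y x with h | h
  · simp [h, not_lt.2 h]
  · simp [h, not_le.2 h]

variable {E : Type*} [NormedAddCommGroup E] [NormedSpace ℝ E] [CompleteSpace E]

theorem isWeakDeriv_primitive {a b : ℝ} (hab : a < b) {g : ℝ → E}
    (hg : Integrable g (intervalMeasure a b)) (c : E) :
    IsWeakDeriv a b (fun x => c + ∫ y in a..x, g y) g := by
  intro φ h1 h2 h3
  have hd : Continuous (deriv φ) := h1.continuous_deriv (by simp)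
  have hφa : φ a = 0 := image_eq_zero_of_notMem_tsupport fun h => lt_irrefl a (h3 h).1
  have hφb : φ b = 0 := image_eq_zero_of_notMem_tsupport fun h => lt_irrefl b (h3 h).2
  have hprim : ∀ x, ∫ y in a..x, deriv φ y = φ x := fun x => by
    rw [intervalIntegral.integral_deriv_eq_sub (fun y _ => h1.differentiable (by simp) y)
      (hd.intervalIntegrable _ _), hφa, sub_zero]
  have hdi : Integrable (deriv φ) (intervalMeasure a b) :=
    (hd.integrable_of_hasCompactSupport h2.deriv).restrict
  have hint : ∫ x in Ioo a b, deriv φ x = 0 := by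
    rw [← integral_Ioc_eq_integral_Ioo, ← intervalIntegral.integral_of_le hab.le, hprim, hφb]
  have h := integral_smul_primitive_add hdi hg
  simp only [hprim, hint, zero_smul] at h
  have hG : Integrable (fun x => deriv φ x • ∫ y in a..x, g y) (intervalMeasure a b) := by
    have : IntegrableOn (fun x => deriv φ x • ∫ y in a..x, g y) (Icc a b) :=
      (hd.continuousOn.smul (continuousOn_primitive hab.le hg)).integrableOn_Icc
    exact this.mono_set Ioo_subset_Icc_self
  simp only [smul_add]
  rw [integral_add (hdi.smul_const c) hG, integral_smul_const, hint, zero_smul, zero_add]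
  exact eq_neg_of_add_eq_zero_left h

/-- The primitive of a test function on `(a,b)` of mean zero is a test function on `(a,b)`. -/
theorem primitive_isTest {a b : ℝ} {h : ℝ → ℝ} (hs : ContDiff ℝ ∞ h) {K : Set ℝ}
    (hK : IsCompact K) (hKne : K.Nonempty) (hKab : K ⊆ Ioo a b) (hsupp : Function.support h ⊆ K)
    (h0 : ∫ y, h y = 0) :
    ContDiff ℝ ∞ (fun x => ∫ y in a..x, h y) ∧ HasCompactSupport (fun x => ∫ y in a..x, h y) ∧
      tsupport (fun x => ∫ y in a..x, h y) ⊆ Ioo a b ∧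
        deriv (fun x => ∫ y in a..x, h y) = h := by
  obtain ⟨c, hc, hcl⟩ := hK.exists_isLeast hKne
  obtain ⟨d, hd, hdg⟩ := hK.exists_isGreatest hKne
  have hderiv : ∀ x, HasDerivAt (fun x => ∫ y in a..x, h y) (h x) x := fun x =>
    hs.continuous.integral_hasStrictDerivAt a x |>.hasDerivAt
  have hderiv' : deriv (fun x => ∫ y in a..x, h y) = h := funext fun x => (hderiv x).deriv
  have hsub : Function.support (fun x => ∫ y in a..x, h y) ⊆ Icc c d := by
    intro x hx
    by_contra hcon
    refine hx ?_
    rcases lt_or_ge x c with hxc | hxc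
    · refine intervalIntegral.integral_zero_ae (ae_of_all _ fun y hy => ?_)
      by_contra hy0
      have h1 : y ≤ max a x := hy.2
      exact absurd (hcl (hsupp hy0)) (not_le.2 (h1.trans_lt (max_lt (hKab hc).1 hxc)))
    · have hdx : d < x := by
        by_contra hh
        exact hcon ⟨hxc, not_lt.1 hh⟩
      change ∫ y in a..x, h y = 0
      rw [intervalIntegral.integral_eq_integral_of_support_subset, h0]
      exact fun y hy => ⟨(hKab (hsupp hy)).1, (hdg (hsupp hy)).trans hdx.le⟩
  have hts : tsupport (fun x => ∫ y in a..x, h y) ⊆ Icc c d :=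
    closure_minimal hsub isClosed_Icc
  refine ⟨?_, HasCompactSupport.intro (isCompact_Icc (a := c) (b := d)) fun x hx => ?_, ?_, hderiv'⟩
  · rw [contDiff_infty_iff_deriv, hderiv']
    exact ⟨fun x => (hderiv x).differentiableAt, hs⟩
  · exact Function.notMem_support.1 fun hh => hx (hsub hh)
  · exact hts.trans fun x hx => ⟨(hKab hc).1.trans_le hx.1, hx.2.trans_lt (hKab hd).2⟩

/-- The lemma of du Bois-Reymond: a function with weak derivative zero is constant. -/
theorem IsWeakDeriv.ae_eq_const {a b : ℝ} (hab : a < b) {w : ℝ → E}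
    (hw : MemLp w 2 (intervalMeasure a b)) (h : IsWeakDeriv a b w fun _ => 0) :
    ∃ c, w =ᵐ[intervalMeasure a b] fun _ => c := by
  let η₀ : ContDiffBump ((a + b) / 2) :=
    ⟨(b - a) / 8, (b - a) / 4, by linarith, by linarith⟩
  set η := η₀.normed volume with hη
  have hηs : ContDiff ℝ ∞ η := η₀.contDiff_normed
  have hηc : HasCompactSupport η := η₀.hasCompactSupport_normed
  have hη1 : ∫ x, η x = 1 := η₀.integral_normed
  have hηt : tsupport η ⊆ Ioo a b := by
    rw [hη, η₀.tsupport_normed_eq, Real.closedBall_eq_Icc]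
    intro x hx
    simp only [η₀, mem_Icc] at hx
    constructor <;> linarith [hx.1, hx.2]
  have hηne : (tsupport η).Nonempty := by
    rw [hη, η₀.tsupport_normed_eq]
    exact ⟨_, Metric.mem_closedBall_self η₀.rOut_pos.le⟩
  set c := ∫ x in Ioo a b, η x • w x with hc
  refine ⟨c, ?_⟩
  have hconst : MemLp (fun _ : ℝ => c) 2 (intervalMeasure a b) := memLp_const c
  have hi : Integrable (fun x => w x - c) (intervalMeasure a b) :=
    (hw.sub hconst).integrable (by norm_num)
  have key : ∀ᵐ x ∂volume, x ∈ Ioo a b → w x - c = 0 := by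
    refine isOpen_Ioo.ae_eq_zero_of_integral_contDiff_smul_eq_zero
      (IntegrableOn.locallyIntegrableOn hi) fun ψ h1 h2 h3 => ?_
    have e : ∀ F : ℝ → E, ∫ x, ψ x • F x = ∫ x in Ioo a b, ψ x • F x := fun F => by
      symm
      refine setIntegral_eq_integral_of_forall_compl_eq_zero fun x hx => ?_
      rw [image_eq_zero_of_notMem_tsupport (fun hh => hx (h3 hh)), zero_smul]
    have e' : ∫ x in Ioo a b, ψ x = ∫ x, ψ x :=
      setIntegral_eq_integral_of_forall_compl_eq_zero fun x hx =>
        image_eq_zero_of_notMem_tsupport fun hh => hx (h3 hh)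
    have hψi : Integrable ψ := h1.continuous.integrable_of_hasCompactSupport h2
    have hηi : Integrable η := hηs.continuous.integrable_of_hasCompactSupport hηc
    -- subtracting a multiple of `η` gives a test function of mean zero, a derivative
    set m := ∫ x, ψ x with hm
    have hmean : ∫ x, (ψ x - m * η x) = 0 := by
      rw [integral_sub hψi (hηi.const_mul m), integral_const_mul, hη1, mul_one, sub_self]
    obtain ⟨k1, k2, k3, k4⟩ := primitive_isTest (a := a) (b := b)
      (h1.sub (contDiff_const.mul hηs)) (h2.isCompact.union hηc.isCompact)
      (hηne.mono subset_union_right) (union_subset h3 hηt) (fun x hx => by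
        by_contra hcon
        rw [mem_union, not_or] at hcon
        exact hx (by simp [image_eq_zero_of_notMem_tsupport hcon.1,
          image_eq_zero_of_notMem_tsupport hcon.2])) hmean
    have h5 := h _ k1 k2 k3
    rw [k4] at h5
    simp only [smul_zero, integral_zero, neg_zero, sub_smul, mul_smul] at h5
    rw [integral_sub (integrable_smul_test hw h1.continuous h2)
      ((integrable_smul_test hw hηs.continuous hηc).fun_smul m), integral_smul, ← hc] at h5
    rw [e]
    simp only [smul_sub]
    rw [integral_sub (integrable_smul_test hw h1.continuous h2)
      (integrable_smul_test hconst h1.continuous h2), integral_smul_const, e']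
    exact h5
  have := (ae_restrict_iff' (μ := volume) measurableSet_Ioo).2 key
  filter_upwards [this] with x hx
  exact sub_eq_zero.1 hx

/-- The continuous representative of a function in `H¹(a,b)` is a primitive of the weak
derivative. -/
theorem IsWeakDeriv.eq_primitive {a b : ℝ} (hab : a < b) {u g v : ℝ → E}
    (hu : MemLp u 2 (intervalMeasure a b)) (hg : MemLp g 2 (intervalMeasure a b))
    (h : IsWeakDeriv a b u g) (hv : ContinuousOn v (Icc a b)) (hvu : v =ᵐ[intervalMeasure a b] u)
    {x : ℝ} (hx : x ∈ Icc a b) : v x = v a + ∫ y in a..x, g y := by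
  have hgi : Integrable g (intervalMeasure a b) := hg.integrable (by norm_num)
  have hcont := continuousOn_primitive hab.le hgi
  obtain ⟨C, hC⟩ := isCompact_Icc.exists_bound_of_continuousOn hcont
  have hG : MemLp (fun x => ∫ y in a..x, g y) 2 (intervalMeasure a b) := by
    refine MemLp.of_bound
      ((hcont.mono Ioo_subset_Icc_self).aestronglyMeasurable measurableSet_Ioo) C ?_
    filter_upwards [ae_restrict_mem measurableSet_Ioo] with x hx
    exact hC x (Ioo_subset_Icc_self hx)
  have hp : IsWeakDeriv a b (fun x => ∫ y in a..x, g y) g := by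
    simpa using isWeakDeriv_primitive hab hgi 0
  have hw : IsWeakDeriv a b (fun x => u x - ∫ y in a..x, g y) fun _ => 0 := by
    intro φ h1 h2 h3
    have hd : Continuous (deriv φ) := h1.continuous_deriv (by simp)
    simp only [smul_sub, smul_zero, integral_zero, neg_zero]
    rw [integral_sub (integrable_smul_test hu hd h2.deriv) (integrable_smul_test hG hd h2.deriv),
      h φ h1 h2 h3, hp φ h1 h2 h3, sub_self]
  obtain ⟨c, hc⟩ := hw.ae_eq_const hab (hu.sub hG)
  have hae : v =ᵐ[volume.restrict (Icc a b)] fun x => c + ∫ y in a..x, g y := by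
    rw [← restrict_Ioo_eq_restrict_Icc]
    filter_upwards [hc, hvu] with x h1 h2
    rw [h2, ← h1, Pi.sub_apply, sub_add_cancel]
  have heq := Measure.eqOn_Icc_of_ae_eq volume hab.ne hae hv (continuousOn_const.add hcont)
  have ha : v a = c := by simpa using heq (left_mem_Icc.2 hab.le)
  rw [ha]
  exact heq hx

end Primitive

/-! ### The energy balance -/

section Balance

theorem integral_star_mul_add {a b : ℝ} (hab : a < b) {f g u v : ℝ → ℂ}
    (hf : MemLp f 2 (intervalMeasure a b)) (hg : MemLp g 2 (intervalMeasure a b))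
    (hu : ∀ x ∈ Icc a b, u x = u a + ∫ y in a..x, f y)
    (hv : ∀ x ∈ Icc a b, v x = v a + ∫ y in a..x, g y) :
    ∫ x in Ioo a b, (star (f x) * v x + star (u x) * g x) =
      star (u b) * v b - star (u a) * v a := by
  have hf1 : Integrable f (intervalMeasure a b) := hf.integrable (by norm_num)
  have hg1 : Integrable g (intervalMeasure a b) := hg.integrable (by norm_num)
  have hf2 : Integrable (fun x => star (f x)) (intervalMeasure a b) :=
    (LinearIsometryEquiv.integrable_comp_iff Complex.conjLIE).2 hf1
  have hstar : ∀ x, ∫ y in a..x, star (f y) = star (∫ y in a..x, f y) := fun x =>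
    intervalIntegral.intervalIntegral_conj
  have hbd : ∀ F G : ℝ → ℂ, Integrable F (intervalMeasure a b) →
      Integrable G (intervalMeasure a b) →
      Integrable (fun x => F x * ∫ y in a..x, G y) (intervalMeasure a b) := by
    intro F G hF hG
    have hc := continuousOn_primitive hab.le hG
    obtain ⟨C, hC⟩ := isCompact_Icc.exists_bound_of_continuousOn hc
    refine hF.mul_bdd (c := C)
      ((hc.mono Ioo_subset_Icc_self).aestronglyMeasurable measurableSet_Ioo) ?_
    filter_upwards [ae_restrict_mem measurableSet_Ioo] with x hx
    exact hC x (Ioo_subset_Icc_self hx)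
  have hends : ∀ F : ℝ → ℂ, ∫ x in Ioo a b, F x = ∫ x in a..b, F x := fun F => by
    rw [intervalIntegral.integral_of_le hab.le, integral_Ioc_eq_integral_Ioo]
  have h := integral_smul_primitive_add hf2 hg1
  simp only [smul_eq_mul, hstar] at h
  have h1 : ∫ x in Ioo a b, (star (f x) * v x + star (u x) * g x) =
      ∫ x in Ioo a b, ((star (f x) * v a + star (u a) * g x) +
        (star (f x) * (∫ y in a..x, g y) + star (∫ y in a..x, f y) * g x)) := by
    refine setIntegral_congr_fun measurableSet_Ioo fun x hx => ?_
    rw [hu x (Ioo_subset_Icc_self hx), hv x (Ioo_subset_Icc_self hx), star_add]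
    ring
  have h2 : Integrable (fun x => star (∫ y in a..x, f y) * g x) (intervalMeasure a b) := by
    refine (hbd g _ hg1 hf2).congr (ae_of_all _ fun x => ?_)
    simp only [hstar]
    ring
  rw [h1, integral_add ((hf2.mul_const _).fun_add (hg1.const_mul _)) ((hbd _ _ hf2 hg1).fun_add h2),
    integral_add (hf2.mul_const _) (hg1.const_mul _), integral_add (hbd _ _ hf2 hg1) h2, h,
    integral_mul_const, integral_const_mul, hends, hends, hstar, hu b (right_mem_Icc.2 hab.le),
    hv b (right_mem_Icc.2 hab.le), star_add]
  ring

variable {ι : Type*} [Fintype ι]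

theorem inner_matVec_left (P : Matrix ι ι ℂ) (v w : EuclideanSpace ℂ ι) :
    inner ℂ (matVec P v) w = ∑ i, ∑ j, star (P i j) * (star (v j) * w i) := by
  rw [PiLp.inner_apply]
  refine Finset.sum_congr rfl fun i _ => ?_
  rw [matVec_apply, RCLike.inner_apply, map_sum, Finset.mul_sum]
  refine Finset.sum_congr rfl fun j _ => ?_
  rw [map_mul]
  simp only [Complex.star_def]
  ring

theorem inner_matVec_comm {P : Matrix ι ι ℂ} (hP : P.IsHermitian) (v w : EuclideanSpace ℂ ι) :
    inner ℂ (matVec P v) w = inner ℂ v (matVec P w) := by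
  rw [← inner_conj_symm v, inner_matVec_left, inner_matVec_left, map_sum, Finset.sum_comm]
  refine Finset.sum_congr rfl fun j _ => ?_
  rw [map_sum]
  refine Finset.sum_congr rfl fun i _ => ?_
  rw [hP.apply j i |>.symm]
  simp only [Complex.star_def, map_mul, Complex.conj_conj]
  ring

theorem primitive_apply {a b : ℝ} {g v : ℝ → EuclideanSpace ℂ ι}
    (hg : Integrable g (intervalMeasure a b))
    (hv : ∀ x ∈ Icc a b, v x = v a + ∫ y in a..x, g y) (i : ι) {x : ℝ} (hx : x ∈ Icc a b) :
    v x i = v a i + ∫ y in a..x, g y i := by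
  have h := (EuclideanSpace.proj (𝕜 := ℂ) i :
    EuclideanSpace ℂ ι →L[ℂ] ℂ).intervalIntegral_comp_comm (intervalIntegrable_of_integrable hg hx)
  refine (congrArg (fun w : EuclideanSpace ℂ ι => w i) (hv x hx)).trans ?_
  exact congrArg (v a i + ·) h.symm

/-- The power `∫ Re ⟪P v', v⟫` depends only on the values of `v` at the end points. -/
theorem re_integral_inner_matVec {a b : ℝ} (hab : a < b) {P : Matrix ι ι ℂ} (hP : P.IsHermitian)
    {g v : ℝ → EuclideanSpace ℂ ι} (hg : MemLp g 2 (intervalMeasure a b))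
    (hvL : MemLp v 2 (intervalMeasure a b)) (hv : ∀ x ∈ Icc a b, v x = v a + ∫ y in a..x, g y) :
    2 * (∫ x in Ioo a b, inner ℂ (matVec P (g x)) (v x)).re =
      (inner ℂ (matVec P (v b)) (v b)).re - (inner ℂ (matVec P (v a)) (v a)).re := by
  have hg1 : Integrable g (intervalMeasure a b) := hg.integrable (by norm_num)
  have hcoord : ∀ {u : ℝ → EuclideanSpace ℂ ι}, MemLp u 2 (intervalMeasure a b) → ∀ j,
      MemLp (fun x => u x j) 2 (intervalMeasure a b) := fun hu j =>
    (EuclideanSpace.proj (𝕜 := ℂ) j : EuclideanSpace ℂ ι →L[ℂ] ℂ).comp_memLp' hu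
  have hmul : ∀ {u w : ℝ → EuclideanSpace ℂ ι}, MemLp u 2 (intervalMeasure a b) →
      MemLp w 2 (intervalMeasure a b) → ∀ i j,
      Integrable (fun x => star (u x j) * w x i) (intervalMeasure a b) := fun hu hw i j =>
    (hcoord hu j).star.integrable_mul (hcoord hw i)
  have hin : ∀ {u w : ℝ → EuclideanSpace ℂ ι}, MemLp u 2 (intervalMeasure a b) →
      MemLp w 2 (intervalMeasure a b) →
      Integrable (fun x => inner ℂ (matVec P (u x)) (w x)) (intervalMeasure a b) := by
    intro u w hu hw
    simp only [inner_matVec_left]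
    exact integrable_finsetSum _ fun i _ => integrable_finsetSum _ fun j _ =>
      (hmul hu hw i j).const_mul _
  have h1 : (∫ x in Ioo a b, inner ℂ (matVec P (g x)) (v x)) +
      ∫ x in Ioo a b, inner ℂ (matVec P (v x)) (g x) =
      inner ℂ (matVec P (v b)) (v b) - inner ℂ (matVec P (v a)) (v a) := by
    rw [← integral_add (hin hg hvL) (hin hvL hg)]
    simp only [inner_matVec_left, ← Finset.sum_add_distrib, ← Finset.sum_sub_distrib, ← mul_add,
      ← mul_sub]
    have hij : ∀ i j, Integrable
        (fun x => star (P i j) * (star (g x j) * v x i + star (v x j) * g x i))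
        (intervalMeasure a b) := fun i j =>
      ((hmul hg hvL i j).add (hmul hvL hg i j)).const_mul _
    rw [integral_finsetSum _ fun i _ => integrable_finsetSum _ fun j _ => hij i j]
    refine Finset.sum_congr rfl fun i _ => ?_
    rw [integral_finsetSum _ fun j _ => hij i j]
    refine Finset.sum_congr rfl fun j _ => ?_
    rw [integral_const_mul]
    congr 1
    exact integral_star_mul_add hab (hcoord hg j) (hcoord hg i)
      (fun x hx => primitive_apply hg1 hv j hx) (fun x hx => primitive_apply hg1 hv i hx)
  have h2 : ∫ x in Ioo a b, inner ℂ (matVec P (v x)) (g x) =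
      star (∫ x in Ioo a b, inner ℂ (matVec P (g x)) (v x)) := by
    rw [Complex.star_def, ← integral_conj]
    refine integral_congr_ae (ae_of_all _ fun x => ?_)
    simp only
    rw [inner_conj_symm, inner_matVec_comm hP]
  have h3 := congrArg Complex.re h1
  rw [h2, Complex.add_re, Complex.sub_re, Complex.star_def, Complex.conj_re] at h3
  linarith

end Balance

/-! ### Completeness of the energy space -/

section Complete

variable {ι : Type*} [Fintype ι] [DecidableEq ι] {a b : ℝ} (H : HamiltonianDensity a b ι)

/-- Multiplication by `ℋ`, as a linear map on `L₂`. -/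
noncomputable def effortMap : Lp (EuclideanSpace ℂ ι) 2 (intervalMeasure a b) →ₗ[ℂ]
    Lp (EuclideanSpace ℂ ι) 2 (intervalMeasure a b) where
  toFun x := (EnergySpace.memLp_effort (H := H) (EnergySpace.ofL2 x)).toLp
  map_add' x y := (MemLp.toLp_congr _
    ((EnergySpace.memLp_effort (H := H) (EnergySpace.ofL2 x)).add
      (EnergySpace.memLp_effort (EnergySpace.ofL2 y)))
    (EnergySpace.effort_add (H := H) (EnergySpace.ofL2 x) (EnergySpace.ofL2 y))).trans
      (MemLp.toLp_add _ _)
  map_smul' c x := (MemLp.toLp_congr _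
    ((EnergySpace.memLp_effort (H := H) (EnergySpace.ofL2 x)).const_smul c)
    (EnergySpace.effort_smul (H := H) c (EnergySpace.ofL2 x))).trans
      (MemLp.toLp_const_smul c _)

variable {H}

theorem coeFn_effortMap (x : EnergySpace H) :
    effortMap H x.toL2 =ᵐ[intervalMeasure a b] x.effort :=
  x.memLp_effort.coeFn_toLp

theorem energyInner_eq_inner_effortMap (x y : EnergySpace H) :
    energyInner x y = (1 / 2 : ℂ) * inner ℂ x.toL2 (effortMap H y.toL2) := by
  rw [energyInner_eq, L2.inner_def]
  congr 1
  refine integral_congr_ae ?_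
  filter_upwards [coeFn_effortMap y] with ζ hζ
  rw [hζ]

theorem norm_sq_eq_re_inner_effortMap (x : EnergySpace H) :
    ‖x‖ ^ 2 = 1 / 2 * (inner ℂ x.toL2 (effortMap H x.toL2)).re := by
  have h : (energyInner x x).re = ‖x‖ ^ 2 := inner_self_eq_norm_sq (𝕜 := ℂ) x
  rw [← h, energyInner_eq_inner_effortMap]
  simp [Complex.mul_re]

variable (H)

theorem effortMap_coercive : ∃ m : ℝ, 0 < m ∧
    ∀ x, m * ‖x‖ ^ 2 ≤ (inner ℂ x (effortMap H x)).re := by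
  obtain ⟨m, hm, h⟩ := energy_coercive (H := H)
  refine ⟨m, hm, fun x => ?_⟩
  have h1 : (inner ℂ x x).re = ‖x‖ ^ 2 := inner_self_eq_norm_sq (𝕜 := ℂ) x
  have h2 : ∀ y : Lp (EuclideanSpace ℂ ι) 2 (intervalMeasure a b),
      (inner ℂ x y).re = ∫ ζ in Ioo a b, (inner ℂ (x ζ) (y ζ)).re := fun y => by
    rw [L2.inner_def]
    exact (integral_re (𝕜 := ℂ) (L2.integrable_inner (𝕜 := ℂ) x y)).symm
  rw [← h1, h2, h2, ← integral_const_mul]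
  refine integral_mono_ae ((L2.integrable_inner (𝕜 := ℂ) x x).re.const_mul m)
    (L2.integrable_inner (𝕜 := ℂ) x (effortMap H x)).re ?_
  filter_upwards [h (EnergySpace.ofL2 x), coeFn_effortMap (H := H) (EnergySpace.ofL2 x)]
    with ζ h3 h4
  have h5 : (inner ℂ (x ζ) (x ζ)).re = ‖x ζ‖ ^ 2 := inner_self_eq_norm_sq (𝕜 := ℂ) _
  rw [h5]
  refine h3.trans (le_of_eq ?_)
  rw [← h4]
  rfl

theorem continuous_effortMap : Continuous (effortMap H) := by
  obtain ⟨m, hm, h⟩ := effortMap_coercive H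
  have hd : IsDissipative (-effortMap H) := fun x => by
    have h1 : (inner ℂ (effortMap H x) x).re = (inner ℂ x (effortMap H x)).re :=
      inner_re_symm (𝕜 := ℂ) _ _
    have h2 : 0 ≤ m * ‖x‖ ^ 2 := by positivity
    rw [LinearMap.neg_apply, inner_neg_left, Complex.neg_re, h1]
    linarith [h x]
  have h1 := hd.continuous.neg
  simpa using h1

theorem effortMap_bijective : Function.Bijective (effortMap H) := by
  obtain ⟨m, hm, h⟩ := effortMap_coercive H
  set M : Lp (EuclideanSpace ℂ ι) 2 (intervalMeasure a b) →L[ℂ]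
    Lp (EuclideanSpace ℂ ι) 2 (intervalMeasure a b) := ⟨effortMap H, continuous_effortMap H⟩
  have hM : IsUnit M := by
    refine ContinuousLinearMap.isUnit_of_forall_le_norm_inner_map M (c := ⟨m, hm.le⟩) hm
      fun x => ?_
    rw [mul_comm, ← norm_inner_symm]
    exact (h x).trans (Complex.re_le_norm _)
  exact ContinuousLinearMap.isUnit_iff_bijective.1 hM

/-- The norm of the energy space is equivalent to that of `L₂`, so the energy space is complete. -/
instance : CompleteSpace (EnergySpace H) := by
  obtain ⟨m, hm, h⟩ := effortMap_coercive H
  set M : Lp (EuclideanSpace ℂ ι) 2 (intervalMeasure a b) →L[ℂ]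
    Lp (EuclideanSpace ℂ ι) 2 (intervalMeasure a b) := ⟨effortMap H, continuous_effortMap H⟩
  let e : EnergySpace H ≃ₗ[ℂ] Lp (EuclideanSpace ℂ ι) 2 (intervalMeasure a b) :=
    { toFun := EnergySpace.toL2
      invFun := EnergySpace.ofL2
      map_add' := fun _ _ => rfl
      map_smul' := fun _ _ => rfl
      left_inv := fun _ => rfl
      right_inv := fun _ => rfl }
  have h1 : ∀ x : EnergySpace H, ‖e x‖ ≤ √(2 / m) * ‖x‖ := fun x => by
    refine le_of_sq_le_sq ?_ (by positivity)
    rw [mul_pow, Real.sq_sqrt (by positivity), norm_sq_eq_re_inner_effortMap x]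
    have h2 := h (e x)
    have h3 : ‖e x‖ ^ 2 ≤ (inner ℂ (e x) (effortMap H (e x))).re / m := by
      rw [le_div_iff₀ hm, mul_comm]
      exact h2
    refine h3.trans (le_of_eq ?_)
    change (inner ℂ (e x) (effortMap H (e x))).re / m =
      2 / m * (1 / 2 * (inner ℂ (e x) (effortMap H (e x))).re)
    ring
  have h2 : ∀ y, ‖e.symm y‖ ≤ √(‖M‖) * ‖y‖ := fun y => by
    refine le_of_sq_le_sq ?_ (by positivity)
    rw [mul_pow, Real.sq_sqrt (by positivity), norm_sq_eq_re_inner_effortMap]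
    have h3 : (inner ℂ y (M y)).re ≤ ‖M‖ * ‖y‖ ^ 2 := by
      refine (Complex.re_le_norm _).trans ((norm_inner_le_norm _ _).trans ?_)
      nlinarith [M.le_opNorm y, norm_nonneg y]
    have h4 : 0 ≤ ‖M‖ * ‖y‖ ^ 2 := by positivity
    change 1 / 2 * (inner ℂ y (M y)).re ≤ _
    linarith
  let E := e.toContinuousLinearEquivOfBounds _ _ h1 h2
  exact (completeSpace_congr (e := E.toEquiv) E.isUniformEmbedding).2 inferInstance

end Complete

/-! ### Port-Hamiltonian operators of first order -/

section Generator

variable {ι κ : Type*} [Fintype ι] {a b : ℝ}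

theorem matVec_mul (P Q : Matrix ι ι ℂ) (v : EuclideanSpace ℂ ι) :
    matVec (P * Q) v = matVec P (matVec Q v) := by
  simp [matVec, Matrix.mulVec_mulVec]

variable [DecidableEq ι]

theorem matVec_one (v : EuclideanSpace ℂ ι) : matVec (1 : Matrix ι ι ℂ) v = v := by
  simp [matVec]

variable {H : HamiltonianDensity a b ι} {P Q : Matrix ι ι ℂ} {W : Matrix κ (ι ⊕ ι) ℂ}

theorem coeFn_operator (x : (operator P H W).domain) :
    (operator P H W x).toL2 =ᵐ[intervalMeasure a b]
      fun ζ => matVec P (weakDeriv (memH1_effort x) ζ) :=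
  (memLp_const_matVec P (memLp_weakDeriv (memH1_effort x))).coeFn_toLp

/-- The continuous representative of `ℋx` for `x` in the domain. -/
theorem exists_effort_eq_primitive (hab : a < b) (x : (operator P H W).domain) :
    ∃ v : ℝ → EuclideanSpace ℂ ι, v =ᵐ[intervalMeasure a b] x.1.effort ∧
      W *ᵥ Sum.elim (v b).ofLp (v a).ofLp = 0 ∧
        ∀ ζ ∈ Icc a b, v ζ = v a + ∫ y in a..ζ, weakDeriv (memH1_effort x) y := by
  obtain ⟨-, v, hv, hvx, hW⟩ := x.2
  exact ⟨v, hvx, hW, fun ζ hζ => (isWeakDeriv_weakDeriv (memH1_effort x)).eq_primitive hab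
    (memH1_effort x).1 (memLp_weakDeriv (memH1_effort x)) hv hvx hζ⟩

/-- If the boundary conditions never let power into the system, the operator is dissipative. -/
theorem re_inner_operator_le (hab : a < b) (hP : P.IsHermitian)
    (hdiss : ∀ u w : EuclideanSpace ℂ ι, W *ᵥ Sum.elim u.ofLp w.ofLp = 0 →
      (inner ℂ (matVec P u) u).re ≤ (inner ℂ (matVec P w) w).re)
    (x : (operator P H W).domain) : (inner ℂ (operator P H W x) (x : EnergySpace H)).re ≤ 0 := by
  obtain ⟨v, hvx, hW, hv⟩ := exists_effort_eq_primitive hab x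
  have h1 := re_integral_inner_matVec hab hP (memLp_weakDeriv (memH1_effort x))
    ((memLp_congr_ae hvx).2 (memH1_effort x).1) hv
  have h2 : inner ℂ (operator P H W x) (x : EnergySpace H) = (1 / 2 : ℂ) *
      ∫ ζ in Ioo a b, inner ℂ (matVec P (weakDeriv (memH1_effort x) ζ)) (v ζ) := by
    refine (energyInner_eq _ _).trans ?_
    congr 1
    refine integral_congr_ae ?_
    filter_upwards [coeFn_operator x, hvx] with ζ h3 h4
    rw [h3, h4]
  have h3 : ∀ z : ℂ, ((1 / 2 : ℂ) * z).re = 1 / 2 * z.re := fun z => by simp [Complex.mul_re]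
  rw [h2, h3]
  linarith [hdiss _ _ hW]

theorem eq_zero_of_operator_eq_zero (hab : a < b) (hQP : Q * P = 1)
    (huniq : ∀ c : EuclideanSpace ℂ ι, W *ᵥ Sum.elim c.ofLp c.ofLp = 0 → c = 0)
    (x : (operator P H W).domain) (hx : operator P H W x = 0) : x = 0 := by
  obtain ⟨v, hvx, hW, hv⟩ := exists_effort_eq_primitive hab x
  have hg : weakDeriv (memH1_effort x) =ᵐ[intervalMeasure a b] fun _ => 0 := by
    have h0 : (operator P H W x).toL2 = 0 := hx
    have h1 := coeFn_operator x
    rw [h0] at h1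
    filter_upwards [h1, Lp.coeFn_zero (EuclideanSpace ℂ ι) 2 (intervalMeasure a b)] with ζ h2 h3
    rw [h3] at h2
    rw [← matVec_one (weakDeriv _ ζ), ← hQP, matVec_mul, ← h2]
    simp [matVec]
  have hconst : ∀ ζ ∈ Icc a b, v ζ = v a := fun ζ hζ => by
    rw [hv ζ hζ, intervalIntegral.integral_of_le hζ.1, integral_Ioc_eq_integral_Ioo,
      integral_congr_ae (ae_restrict_of_ae_restrict_of_subset (Ioo_subset_Ioo_right hζ.2) hg)]
    simp
  rw [hconst b (right_mem_Icc.2 hab.le)] at hW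
  have hva := huniq _ hW
  have heff : effortMap H x.1.toL2 = 0 := by
    refine Lp.eq_zero_iff_ae_eq_zero.2 ?_
    filter_upwards [coeFn_effortMap x.1, hvx, ae_restrict_mem measurableSet_Ioo] with ζ h1 h2 h3
    rw [h1, ← h2, hconst ζ (Ioo_subset_Icc_self h3), hva]
    rfl
  exact Subtype.ext ((effortMap_bijective H).1 (heff.trans (map_zero (effortMap H)).symm))

/-- The solution of `A x = f` is `ℋx = c + ∫ P⁻¹ f`, with `c` given by the boundary conditions. -/
theorem exists_operator_eq (hab : a < b) (hPQ : P * Q = 1)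
    (hex : ∀ F : EuclideanSpace ℂ ι, ∃ c : EuclideanSpace ℂ ι,
      W *ᵥ Sum.elim (c + F).ofLp c.ofLp = 0)
    (f : EnergySpace H) : ∃ x : (operator P H W).domain, operator P H W x = f := by
  set g : ℝ → EuclideanSpace ℂ ι := fun ζ => matVec Q (f.toL2 ζ)
  have hg : MemLp g 2 (intervalMeasure a b) := memLp_const_matVec Q (Lp.memLp f.toL2)
  have hgi : Integrable g (intervalMeasure a b) := hg.integrable (by norm_num)
  obtain ⟨c, hc⟩ := hex (∫ y in a..b, g y)
  set v : ℝ → EuclideanSpace ℂ ι := fun ζ => c + ∫ y in a..ζ, g y with hvdef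
  have hvc : ContinuousOn v (Icc a b) := continuousOn_const.add (continuousOn_primitive hab.le hgi)
  have hvL : MemLp v 2 (intervalMeasure a b) := by
    obtain ⟨C, hC⟩ := isCompact_Icc.exists_bound_of_continuousOn hvc
    refine MemLp.of_bound
      ((hvc.mono Ioo_subset_Icc_self).aestronglyMeasurable measurableSet_Ioo) C ?_
    filter_upwards [ae_restrict_mem measurableSet_Ioo] with ζ hζ
    exact hC ζ (Ioo_subset_Icc_self hζ)
  obtain ⟨x, hx⟩ := (effortMap_bijective H).2 hvL.toLp
  have hvx : v =ᵐ[intervalMeasure a b] (EnergySpace.ofL2 (H := H) x).effort := by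
    have h1 := coeFn_effortMap (H := H) (EnergySpace.ofL2 x)
    have h2 : effortMap H (EnergySpace.ofL2 (H := H) x).toL2 = hvL.toLp := hx
    rw [h2] at h1
    exact hvL.coeFn_toLp.symm.trans h1
  have hweak := (isWeakDeriv_primitive hab hgi c).congr hvx
  have hdom : EnergySpace.ofL2 x ∈ (operator P H W).domain := by
    refine ⟨⟨EnergySpace.memLp_effort _, g, hg, hweak⟩, v, hvc, hvx, ?_⟩
    simpa [hvdef] using hc
  refine ⟨⟨_, hdom⟩, ?_⟩
  have hd := (isWeakDeriv_weakDeriv (memH1_effort ⟨_, hdom⟩)).unique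
    (memLp_weakDeriv (memH1_effort ⟨_, hdom⟩)) hg hweak
  refine Lp.ext (f := (operator P H W ⟨_, hdom⟩).toL2) (g := f.toL2) ?_
  filter_upwards [coeFn_operator ⟨_, hdom⟩, hd] with ζ h1 h2
  rw [h1, h2, ← matVec_mul, hPQ, matVec_one]

/-- A port-Hamiltonian operator `P d/dζ ℋ` generates a contraction semigroup if its boundary
conditions are dissipative and make `0` a point of the resolvent set; both are conditions on the
boundary matrix `W` alone. -/
theorem operator_generatesContractionSemigroup (hab : a < b) (hP : P.IsHermitian)
    (hPQ : P * Q = 1)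
    (hdiss : ∀ u w : EuclideanSpace ℂ ι, W *ᵥ Sum.elim u.ofLp w.ofLp = 0 →
      (inner ℂ (matVec P u) u).re ≤ (inner ℂ (matVec P w) w).re)
    (huniq : ∀ c : EuclideanSpace ℂ ι, W *ᵥ Sum.elim c.ofLp c.ofLp = 0 → c = 0)
    (hex : ∀ F : EuclideanSpace ℂ ι, ∃ c : EuclideanSpace ℂ ι,
      W *ᵥ Sum.elim (c + F).ofLp c.ofLp = 0) :
    GeneratesContractionSemigroup (operator P H W) :=
  generatesContractionSemigroup_of_bijective _ (re_inner_operator_le hab hP hdiss)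
    (eq_zero_of_operator_eq_zero hab (mul_eq_one_comm.1 hPQ) huniq)
    (exists_operator_eq hab hPQ hex)

end Generator

/-! ### The boundary conditions of the network -/

section Boundary

theorem stringP_isHermitian : stringP.IsHermitian := by
  ext i j
  fin_cases i <;> fin_cases j <;> simp [stringP]

theorem stringP_mul_self : stringP * stringP = 1 := by
  ext i j
  fin_cases i <;> fin_cases j <;> simp [stringP, Matrix.mul_apply, Fin.sum_univ_six]

/-- The boundary conditions written out, for the values `u` at `b` and `w` at `a`. -/
theorem stringW_mulVec_eq_zero_iff (β : ℝ) (u w : Fin 6 → ℂ) :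
    stringW β *ᵥ Sum.elim u w = 0 ↔ (u 0 = u 2 ∧ u 0 = u 4 ∧ β * u 0 + u 1 + u 3 + u 5 = 0) ∧
      w 0 = 0 ∧ w 3 = 0 ∧ w 5 = 0 := by
  rw [stringW, Matrix.fromCols_mulVec_sumElim, funext_iff]
  simp only [Fin.forall_fin_succ]
  simp [← sub_eq_add_neg, sub_eq_zero, and_assoc, add_assoc]
  rfl

theorem re_inner_stringP (u : EuclideanSpace ℂ (Fin 6)) :
    (inner ℂ (matVec stringP u) u).re =
      2 * (star (u 1) * u 0 + star (u 3) * u 2 + star (u 5) * u 4).re := by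
  rw [inner_matVec_left]
  simp [Fin.sum_univ_six, stringP]
  ring

/-- At `a` the power of each string vanishes. At `b` the velocities have a common value `z` and
the forces add up to `-β z`, so that the total power is `-2 β |z| ^ 2`. -/
theorem stringW_dissipative {β : ℝ} (hβ : 0 ≤ β) (u w : EuclideanSpace ℂ (Fin 6))
    (h : stringW β *ᵥ Sum.elim u.ofLp w.ofLp = 0) :
    (inner ℂ (matVec stringP u) u).re ≤ (inner ℂ (matVec stringP w) w).re := by
  obtain ⟨⟨h1, h2, h3⟩, h4, h5, h6⟩ := (stringW_mulVec_eq_zero_iff β _ _).1 h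
  rw [re_inner_stringP, re_inner_stringP, h4, h5, h6, ← h1, ← h2]
  have h7 : star (u 1) * u 0 + star (u 3) * u 0 + star (u 5) * u 0 =
      ((-(β * Complex.normSq (u 0)) : ℝ) : ℂ) := by
    have h8 : u 1 + u 3 + u 5 = -(β * u 0) := by linear_combination h3
    have h9 := congrArg star h8
    simp only [star_add, star_neg, star_mul', Complex.star_def, Complex.conj_ofReal] at h9 ⊢
    rw [← add_mul, ← add_mul, h9]
    push_cast
    rw [Complex.normSq_eq_conj_mul_self]
    ring
  rw [h7, Complex.ofReal_re]
  have h8 := mul_nonneg hβ (Complex.normSq_nonneg (u 0))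
  simp
  linarith

theorem stringW_unique (β : ℝ) (c : EuclideanSpace ℂ (Fin 6))
    (h : stringW β *ᵥ Sum.elim c.ofLp c.ofLp = 0) : c = 0 := by
  obtain ⟨⟨h1, h2, h3⟩, h4, h5, h6⟩ := (stringW_mulVec_eq_zero_iff β _ _).1 h
  rw [h4] at h1 h2 h3
  have h7 : c 1 = 0 := by linear_combination h3 - h5 - h6
  ext i
  fin_cases i
  · exact h4
  · exact h7
  · exact h1.symm
  · exact h5
  · exact h2.symm
  · exact h6

theorem stringW_exists (β : ℝ) (F : EuclideanSpace ℂ (Fin 6)) :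
    ∃ c : EuclideanSpace ℂ (Fin 6), stringW β *ᵥ Sum.elim (c + F).ofLp c.ofLp = 0 := by
  refine ⟨!₂[0, -(β * F 0 + F 1 + F 3 + F 5), F 0 - F 2, 0, F 0 - F 4, 0],
    (stringW_mulVec_eq_zero_iff β _ _).2 ⟨⟨?_, ?_, ?_⟩, ?_, ?_, ?_⟩⟩ <;> simp
  ring

end Boundary
end PortHamiltonian

theorem mainTheorem11 (a b : ℝ) (hab : a < b) (β : ℝ) (hβ : 0 ≤ β) (T ρ : Fin 3 → ℝ → ℝ)
    (hT : ∀ k, MemLp (T k) ⊤ (volume.restrict (Ioo a b)))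
    (hρ : ∀ k, MemLp (ρ k) ⊤ (volume.restrict (Ioo a b)))
    (hpos : ∃ ε₀ : ℝ, 0 < ε₀ ∧
      ∀ k, ∀ᵐ ζ ∂(volume.restrict (Ioo a b)), ε₀ ≤ T k ζ ∧ ε₀ ≤ ρ k ζ) :
    PortHamiltonian.GeneratesContractionSemigroup
      (PortHamiltonian.operator PortHamiltonian.stringP
        (PortHamiltonian.stringDensity T ρ hT hρ hpos) (PortHamiltonian.stringW β)) :=
  PortHamiltonian.operator_generatesContractionSemigroup hab PortHamiltonian.stringP_isHermitian
    PortHamiltonian.stringP_mul_self (PortHamiltonian.stringW_dissipative hβ)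
    (PortHamiltonian.stringW_unique β) (PortHamiltonian.stringW_exists β)
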